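/- All manifolds are smooth, finite-dimensional, Hausdorff and second countable, without boundary. A bivector field $\Lambda$ is identified with the map $\Lambda:T^*M\to TM$, $\langle\beta,\Lambda\alpha\rangle=\Lambda(\alpha,\beta)$. A pair $(\Lambda,E)$ of a bivector field and a vector field is a Jacobi structure if $\{f,g\}=\Lambda(df,dg)+\langle f\,dg-g\,df,E\rangle$ satisfies the Jacobi identity on $C^\infty(M)$; $\pi$ is Poisson if $(\pi,0)$ is Jacobi. Two Jacobi structures are compatible if $\{\cdot,\cdot\}_1-\lambda\{\cdot,\cdot\}_2$ is the bracket of a Jacobi structure for every $\lambda\in\mathbb R$. A map $\psi:(M_1,\Lambda_1,E_1)\to(M_2,\Lambda_2,E_2)$ between Jacobi manifolds is a conformal Jacobi morphism if it is smooth and there is a nowhere vanishing $a\in C^\infty(M_1)$ with $\{a(f\circ\psi),a(g\circ\psi)\}_1=a(\{f,g\}_2\circ\psi)$ for all $f,g\in C^\infty(M_2)$. A Nijenhuis tensor is a $(1,1)$-tensor field $J$ with vanishing torsion $N_J(X,Y)=[JX,JY]-J[JX,Y]-J[X,JY]+J^2[X,Y]$. Put $\{\alpha,\beta\}_\Lambda=L_{\Lambda\alpha}\beta-L_{\Lambda\beta}\alpha-d(\Lambda(\alpha,\beta))$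 and, when $J\circ\Lambda=\Lambda\circ{}^tJ$, $C(\Lambda,J)(\alpha,\beta)=\{\alpha,\beta\}_{J\Lambda}-(\{{}^tJ\alpha,\beta\}_\Lambda+\{\alpha,{}^tJ\beta\}_\Lambda-{}^tJ\{\alpha,\beta\}_\Lambda)$. A Nijenhuis tensor $J$ is compatible with a Jacobi structure $(\Lambda,E)$ if (i) $J\circ\Lambda=\Lambda\circ{}^tJ$; (ii) $\langle{}^tJ\gamma,\ \Lambda(C(\Lambda,J)(\alpha,\beta))-\Lambda(\alpha,\beta)JE+\Lambda(\alpha,{}^tJ\beta)E\rangle=0$ for all 1-forms $\alpha,\beta,\gamma$; (iii) $[J^kE,\Lambda]+[E,J^k\Lambda]=0$ for all $k\ge1$. A Poisson–Nijenhuis structure $(\pi,J)$ is a Poisson tensor $\pi$ with a Nijenhuis tensor $J$ such that $J\circ\pi=\pi\circ{}^tJ$ and $C(\pi,J)=0$. It is homogeneous with respect to a vector field $Z$ if $[Z,\pi]=-\pi$ and $\pi\circ(L_Z\circ{}^tJ-{}^tJ\circ L_Z)=0$ on 1-forms. **Corollary.** (1) Let $(\Lambda,E)$ be a Jacobi structure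 on $M$ and $J$ a Nijenhuis tensor on $M$ compatible with $(\Lambda,E)$. Then $(J^k\Lambda,J^kE)$ is a Jacobi structure for every $k\ge0$, and there is a sequence $(\pi_k)_{k\ge0}$ of Poisson structures on $M\times\mathbb R$, each forming a Poisson–Nijenhuis structure $(\pi_k,K_k)$ with some Nijenhuis tensor $K_k$ on $M\times\mathbb R$, such that for every $k\ge0$ the projection $(M\times\mathbb R,\pi_k)\to(M,J^k\Lambda,J^kE)$ is a conformal Jacobi morphism. In particular, for $k=0$ the target is $(M,\Lambda,E)$. (2) Conversely, let $(\pi,J)$ be a Poisson–Nijenhuis structure on $M$ that is homogeneous with respect to the vector field $Z$, and let $\iota:N\to M$ be an immersed (for instance, an embedded) submanifold of codimension 1, transverse to $Z$. Then for every $k\ge0$ there is exactly one pair $(\Lambda_k,E_k)$ of fields on $N$ with $J^k\pi=\iota_*\Lambda_k+Z\wedge\iota_*E_k$ along $N$. Each $(\Lambda_k,E_k)$ is a Jacobi structure on $N$, these Jacobi structures are pairwise compatible, and whenever $f,g$ are smooth functions on an open set $U\subset M$ with $\langle Z,df\rangle=f$ and $\langle Z,dg\rangle=g$ on $U$, the bracket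 $\{\cdot,\cdot\}_k$ of $(\Lambda_k,E_k)$ satisfies $\{f|_N,g|_N\}_k=(J^k\pi)(df,dg)|_N$ on $N\cap U$. -/

import Mathlib

open Bundle Manifold
open scoped ContDiff

namespace JacobiNijenhuis

section Definitions

variable {E : Type*} [NormedAddCommGroup E] [NormedSpace ℝ E]
  {H : Type*} [TopologicalSpace H] (I : ModelWithCorners ℝ E H)
  {M : Type*} [TopologicalSpace M] [ChartedSpace H M]

/-! ### Tensor fields -/

/-- Vector fields on `M` (no regularity). -/
abbrev Vec (M : Type*) [TopologicalSpace M] [ChartedSpace H M] :=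
  Π x : M, TangentSpace I x

/-- Fields of covectors on `M` (no regularity). -/
abbrev Form (M : Type*) [TopologicalSpace M] [ChartedSpace H M] :=
  Π x : M, TangentSpace I x →L[ℝ] ℝ

/-- Fields of linear maps `T*M → TM` (no regularity). A bivector field `Λ` is represented by its
linear map `α ↦ Λ α`, with `Λ(α, β) = ⟨β, Λ α⟩`; it has to be smooth and skew-symmetric, see
`IsBivector`. -/
abbrev Biv (M : Type*) [TopologicalSpace M] [ChartedSpace H M] :=
  Π x : M, (TangentSpace I x →L[ℝ] ℝ) →L[ℝ] TangentSpace I x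

/-- Fields of endomorphisms of `TM`, i.e. (1,1)-tensor fields (no regularity). -/
abbrev Endo (M : Type*) [TopologicalSpace M] [ChartedSpace H M] :=
  Π x : M, TangentSpace I x →L[ℝ] TangentSpace I x

/-- Smooth real functions on `M`. -/
def SmoothFun (f : M → ℝ) : Prop := ContMDiff I 𝓘(ℝ, ℝ) ∞ f

/-- Smoothness of a vector field: it is a smooth section of the tangent bundle. -/
def SmoothVec [IsManifold I ∞ M] (X : Vec I M) : Prop :=
  ContMDiff I (I.prod 𝓘(ℝ, E)) ∞
    (fun x => TotalSpace.mk' E (E := fun x : M => TangentSpace I x) x (X x))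

/-- Smoothness of a 1-form: it is a smooth section of the cotangent bundle. -/
def SmoothForm [IsManifold I ∞ M] (α : Form I M) : Prop :=
  ContMDiff I (I.prod 𝓘(ℝ, E →L[ℝ] ℝ)) ∞
    (fun x => TotalSpace.mk' (E →L[ℝ] ℝ)
      (E := fun x : M => TangentSpace I x →L[ℝ] Trivial M ℝ x) x (α x))

/-- Smoothness of a (1,1)-tensor field: it is a smooth section of `Hom(TM, TM)`. -/
def SmoothEndo [IsManifold I ∞ M] (J : Endo I M) : Prop :=
  ContMDiff I (I.prod 𝓘(ℝ, E →L[ℝ] E)) ∞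
    (fun x => TotalSpace.mk' (E →L[ℝ] E)
      (E := fun x : M => TangentSpace I x →L[ℝ] TangentSpace I x) x (J x))

/-- A bivector field: a smooth skew-symmetric section of `Hom(T*M, TM)`. -/
structure IsBivector [IsManifold I ∞ M] (Λ : Biv I M) : Prop where
  smooth : ContMDiff I (I.prod 𝓘(ℝ, (E →L[ℝ] ℝ) →L[ℝ] E)) ∞
    (fun x => TotalSpace.mk' ((E →L[ℝ] ℝ) →L[ℝ] E)
      (E := fun x : M => (TangentSpace I x →L[ℝ] Trivial M ℝ x) →L[ℝ] TangentSpace I x) x (Λ x))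
  skew : ∀ (x : M) (a b : TangentSpace I x →L[ℝ] ℝ), b (Λ x a) = - a (Λ x b)

/-! ### Algebraic operations -/

/-- The function `Λ(α, β) = ⟨β, Λ α⟩`. -/
noncomputable def pair (Λ : Biv I M) (α β : Form I M) : M → ℝ := fun x => β x (Λ x (α x))

/-- The vector field `Λ α`. -/
noncomputable def sharp (Λ : Biv I M) (α : Form I M) : Vec I M := fun x => Λ x (α x)

/-- The vector field `J X`. -/
noncomputable def app (J : Endo I M) (X : Vec I M) : Vec I M := fun x => J x (X x)

/-- The 1-form `ᵗJ α = α ∘ J`. -/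
noncomputable def transp (J : Endo I M) (α : Form I M) : Form I M := fun x => (α x).comp (J x)

/-- The tensor field `J ∘ Λ`. -/
noncomputable def comp (J : Endo I M) (Λ : Biv I M) : Biv I M := fun x => (J x).comp (Λ x)

/-- The power `J ^ k` (with `J ^ 0` the identity). -/
noncomputable def power (J : Endo I M) (k : ℕ) : Endo I M := fun x => J x ^ k

/-- `J ∘ Λ = Λ ∘ ᵗJ`. -/
def Commutes (J : Endo I M) (Λ : Biv I M) : Prop :=
  ∀ (x : M) (a : TangentSpace I x →L[ℝ] ℝ), J x (Λ x a) = Λ x (a.comp (J x))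

/-! ### Lie derivatives -/

/-- The value at `x` of `(L_X α)(Y) = X(α(Y)) - α([X, Y])`. -/
noncomputable def lieEval (X : Vec I M) (α : Form I M) (x : M) (Y : Vec I M) : ℝ :=
  mvfderiv I (fun y => α y (Y y)) x (X x) - α x (VectorField.mlieBracket I X Y x)

open Classical in
/-- The Lie derivative `L_X α` of a 1-form, characterized by `(L_X α)(Y) = X(α(Y)) - α([X, Y])`,
see `lieForm_apply`. The expression `lieEval I X α x Y` depends only on the value of `Y` at `x` when
`X` and `α` are smooth; the default value `0` only concerns fields that are not smooth. -/
noncomputable def lieForm [FiniteDimensional ℝ E] [IsManifold I ∞ M]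
    (X : Vec I M) (α : Form I M) : Form I M := fun x =>
  if h : TensorialAt I E (lieEval I X α x) x then
    TensorialAt.mkHom (lieEval I X α x) x h
  else 0

/-- The Lie derivative of a bivector field,
`[X, Λ](α, β) = X(Λ(α, β)) - Λ(L_X α, β) - Λ(α, L_X β)`. -/
noncomputable def lieBiv [FiniteDimensional ℝ E] [IsManifold I ∞ M]
    (X : Vec I M) (Λ : Biv I M) (α β : Form I M) : M → ℝ := fun x =>
  mvfderiv I (pair I Λ α β) x (X x) - pair I Λ (lieForm I X α) β x
    - pair I Λ α (lieForm I X β) x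

lemma tensorialAt_lieEval [FiniteDimensional ℝ E] [IsManifold I ∞ M]
    {X : Vec I M} {α : Form I M} (hα : SmoothForm I α) (x : M) :
    TensorialAt I E (lieEval I X α x) x := by
  have key : ∀ {Y : Vec I M}, MDifferentiableAt I (I.prod 𝓘(ℝ, E))
      (fun x => TotalSpace.mk' E (E := fun x : M => TangentSpace I x) x (Y x)) x →
      MDifferentiableAt I 𝓘(ℝ, ℝ) (fun y => α y (Y y)) x := by
    intro Y hY
    have h := (hα x).mdifferentiableAt (by simp)
    have h2 := MDifferentiableAt.clm_bundle_apply (F₁ := E) (F₂ := ℝ)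
      (E₁ := fun x : M => TangentSpace I x) (E₂ := Trivial M ℝ)
      (b := fun x => x) (ϕ := fun x => α x) (v := Y) h hY
    rw [mdifferentiableAt_totalSpace] at h2
    exact h2.2
  constructor
  · intro f Y hf hY
    have e : (fun y => α y ((f • Y) y)) = f * (fun y => α y (Y y)) := by
      ext y; simp
    simp only [lieEval, e]
    rw [VectorField.mlieBracket_smul_right hf hY, mvfderiv_mul hf (key hY)]
    simp
    ring
  · intro Y Y' hY hY'
    have e : (fun y => α y ((Y + Y') y)) = (fun y => α y (Y y)) + (fun y => α y (Y' y)) := by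
      ext y; simp
    simp only [lieEval, e]
    rw [VectorField.mlieBracket_add_right hY hY', mvfderiv_add (key hY) (key hY')]
    simp
    ring

lemma lieForm_apply [FiniteDimensional ℝ E] [IsManifold I ∞ M]
    {X Y : Vec I M} {α : Form I M} (hα : SmoothForm I α) (hY : SmoothVec I Y) (x : M) :
    lieForm I X α x (Y x) =
      mvfderiv I (fun y => α y (Y y)) x (X x) - α x (VectorField.mlieBracket I X Y x) := by
  have h := tensorialAt_lieEval I (X := X) hα x
  simp only [lieForm, dif_pos h]
  exact TensorialAt.mkHom_apply h ((hY x).mdifferentiableAt (by simp))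

/-! ### Jacobi and Poisson structures -/

/-- The bracket `{f, g} = Λ(df, dg) + ⟨f dg - g df, V⟩` of a bivector field `Λ` and a vector
field `V`. -/
noncomputable def bracket (Λ : Biv I M) (V : Vec I M) (f g : M → ℝ) : M → ℝ := fun x =>
  mvfderiv I g x (Λ x (mvfderiv I f x))
    + (f x * mvfderiv I g x (V x) - g x * mvfderiv I f x (V x))

/-- `(Λ, V)` is a Jacobi structure: `Λ` is a bivector field, `V` is a smooth vector field, and their
bracket satisfies the Jacobi identity. (It is bilinear, skew-symmetric and local by its form.) -/
structure IsJacobi [IsManifold I ∞ M] (Λ : Biv I M) (V : Vec I M) : Prop where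
  isBivector : IsBivector I Λ
  smoothVec : SmoothVec I V
  jacobi : ∀ f g h : M → ℝ, SmoothFun I f → SmoothFun I g → SmoothFun I h → ∀ x : M,
    bracket I Λ V f (bracket I Λ V g h) x + bracket I Λ V g (bracket I Λ V h f) x
      + bracket I Λ V h (bracket I Λ V f g) x = 0

/-- A Poisson structure is a Jacobi structure with zero vector field. -/
def IsPoisson [IsManifold I ∞ M] (P : Biv I M) : Prop := IsJacobi I P (fun _ => 0)

/-- Two Jacobi structures are compatible if they define a Jacobi pencil: the difference
`{·,·}₁ - c {·,·}₂` of their brackets is the bracket of a Jacobi structure for all real `c`. -/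
def AreCompatible [IsManifold I ∞ M] (Λ₁ : Biv I M) (V₁ : Vec I M) (Λ₂ : Biv I M) (V₂ : Vec I M) :
    Prop :=
  IsJacobi I Λ₁ V₁ ∧ IsJacobi I Λ₂ V₂ ∧
    ∀ c : ℝ, IsJacobi I (fun x => Λ₁ x - c • Λ₂ x) (fun x => V₁ x - c • V₂ x)

/-! ### Nijenhuis tensors and compatibility -/

/-- The Nijenhuis torsion `N_J(X, Y) = [JX, JY] - J[JX, Y] - J[X, JY] + J²[X, Y]`. -/
noncomputable def torsion (J : Endo I M) (X Y : Vec I M) : Vec I M := fun x =>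
  VectorField.mlieBracket I (app I J X) (app I J Y) x
    - J x (VectorField.mlieBracket I (app I J X) Y x)
    - J x (VectorField.mlieBracket I X (app I J Y) x)
    + J x (J x (VectorField.mlieBracket I X Y x))

/-- A Nijenhuis tensor: a smooth (1,1)-tensor field whose Nijenhuis torsion vanishes. -/
structure IsNijenhuis [IsManifold I ∞ M] (J : Endo I M) : Prop where
  smooth : SmoothEndo I J
  torsion_eq_zero : ∀ X Y : Vec I M, SmoothVec I X → SmoothVec I Y → ∀ x : M,
    torsion I J X Y x = 0

/-- The bracket of 1-forms `{α, β}_Λ = L_{Λα} β - L_{Λβ} α - d(Λ(α, β))`. -/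
noncomputable def formBracket [FiniteDimensional ℝ E] [IsManifold I ∞ M]
    (Λ : Biv I M) (α β : Form I M) : Form I M := fun x =>
  lieForm I (sharp I Λ α) β x - lieForm I (sharp I Λ β) α x - mvfderiv I (pair I Λ α β) x

/-- The concomitant
`C(Λ, J)(α, β) = {α, β}_{JΛ} - ({ᵗJ α, β}_Λ + {α, ᵗJ β}_Λ - ᵗJ {α, β}_Λ)`. -/
noncomputable def concomitant [FiniteDimensional ℝ E] [IsManifold I ∞ M]
    (Λ : Biv I M) (J : Endo I M) (α β : Form I M) : Form I M := fun x =>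
  formBracket I (comp I J Λ) α β x
    - (formBracket I Λ (transp I J α) β x + formBracket I Λ α (transp I J β) x
        - transp I J (formBracket I Λ α β) x)

/-- Compatibility of a (1,1)-tensor field `J` with a Jacobi structure `(Λ, V)`. -/
structure IsCompatible [FiniteDimensional ℝ E] [IsManifold I ∞ M]
    (Λ : Biv I M) (V : Vec I M) (J : Endo I M) : Prop where
  torsion_sharp_sharp : ∀ α β : Form I M, SmoothForm I α → SmoothForm I β → ∀ x : M,
    torsion I J (sharp I Λ α) (sharp I Λ β) x = 0
  torsion_sharp_vec : ∀ (α : Form I M) (k : ℕ), SmoothForm I α → ∀ x : M,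
    torsion I J (sharp I Λ α) (app I (power I J k) V) x = 0
  commutes : Commutes I J Λ
  concomitant_eq : ∀ α β γ : Form I M, SmoothForm I α → SmoothForm I β → SmoothForm I γ →
    ∀ x : M, transp I J γ x (Λ x (concomitant I Λ J α β x) - pair I Λ α β x • J x (V x)
      + pair I Λ α (transp I J β) x • V x) = 0
  lie_eq : ∀ k : ℕ, 1 ≤ k → ∀ α β : Form I M, SmoothForm I α → SmoothForm I β → ∀ x : M,
    lieBiv I (app I (power I J k) V) Λ α β x + lieBiv I V (comp I (power I J k) Λ) α β x = 0

/-- Poisson–Nijenhuis structures. -/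
structure IsPoissonNijenhuis [FiniteDimensional ℝ E] [IsManifold I ∞ M]
    (P : Biv I M) (J : Endo I M) : Prop where
  isPoisson : IsPoisson I P
  isNijenhuis : IsNijenhuis I J
  commutes : Commutes I J P
  concomitant_eq_zero : ∀ α β : Form I M, SmoothForm I α → SmoothForm I β → ∀ x : M,
    concomitant I P J α β x = 0

/-- Homogeneous Poisson–Nijenhuis structures with respect to a vector field `Z`: a
Poisson–Nijenhuis structure with `[Z, P] = -P` and `P ∘ (L_Z ∘ ᵗJ - ᵗJ ∘ L_Z) = 0`. -/
structure IsHomogeneousPoissonNijenhuis [FiniteDimensional ℝ E] [IsManifold I ∞ M]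
    (P : Biv I M) (J : Endo I M) (Z : Vec I M) : Prop where
  isPoissonNijenhuis : IsPoissonNijenhuis I P J
  smoothVec : SmoothVec I Z
  homogeneous : ∀ α β : Form I M, SmoothForm I α → SmoothForm I β → ∀ x : M,
    lieBiv I Z P α β x = - pair I P α β x
  comp_eq_zero : ∀ α : Form I M, SmoothForm I α → ∀ x : M,
    P x (lieForm I Z (transp I J α) x - transp I J (lieForm I Z α) x) = 0

/-! ### Conformal Jacobi morphisms and transverse hypersurfaces -/

variable {E' : Type*} [NormedAddCommGroup E'] [NormedSpace ℝ E']
  {H' : Type*} [TopologicalSpace H'] (I' : ModelWithCorners ℝ E' H')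
  {N : Type*} [TopologicalSpace N] [ChartedSpace H' N]

/-- `ψ : (M, Λ₁, V₁) → (N, Λ₂, V₂)` is a conformal Jacobi morphism: there is a smooth nowhere
vanishing function `a` on `M` with `{a (f ∘ ψ), a (g ∘ ψ)}₁ = a ({f, g}₂ ∘ ψ)` for all smooth
functions `f`, `g` on `N`. -/
structure IsConformalJacobiMorphism [IsManifold I ∞ M] [IsManifold I' ∞ N]
    (Λ₁ : Biv I M) (V₁ : Vec I M) (Λ₂ : Biv I' N) (V₂ : Vec I' N) (ψ : M → N) : Prop where
  source : IsJacobi I Λ₁ V₁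
  target : IsJacobi I' Λ₂ V₂
  smooth : ContMDiff I I' ∞ ψ
  conformal : ∃ a : M → ℝ, SmoothFun I a ∧ (∀ x, a x ≠ 0) ∧
    ∀ f g : N → ℝ, SmoothFun I' f → SmoothFun I' g → ∀ x : M,
      bracket I Λ₁ V₁ (fun y => a y * f (ψ y)) (fun y => a y * g (ψ y)) x
        = a x * bracket I' Λ₂ V₂ f g (ψ x)

/-- `ι : N → M` is an immersion of codimension one, transverse to the vector field `Z`. The
inclusion of a submanifold of codimension one which is transverse to `Z` is an instance. -/
structure IsTransverseHypersurface (Z : Vec I M) (ι : N → M) : Prop where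
  smooth : ContMDiff I' I ∞ ι
  injective : ∀ y : N, Function.Injective (mfderiv I' I ι y)
  codim : Module.finrank ℝ E = Module.finrank ℝ E' + 1
  transverse : ∀ y : N, Z (ι y) ∉ Set.range (mfderiv I' I ι y)

/-- The decomposition `P = ι_* Λ + Z ∧ ι_* V` of a bivector field `P` on `M` along a transverse
hypersurface `ι : N → M`, where `(Z ∧ W)(a, b) = a(Z) b(W) - b(Z) a(W)`. -/
def DecomposesAlong (P : Biv I M) (Z : Vec I M) (ι : N → M) (Λ : Biv I' N) (V : Vec I' N) : Prop :=
  ∀ (y : N) (a b : TangentSpace I (ι y) →L[ℝ] ℝ),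
    b (P (ι y) a) =
      (b.comp (mfderiv I' I ι y)) (Λ y (a.comp (mfderiv I' I ι y)))
        + (a (Z (ι y)) * b (mfderiv I' I ι y (V y)) - b (Z (ι y)) * a (mfderiv I' I ι y (V y)))

/-- For all smooth functions `f`, `g` on an open set `U` of `M` with `⟨Z, df⟩ = f` and
`⟨Z, dg⟩ = g` there, the bracket of their restrictions to `N` with respect to `(Λ, V)` is the
restriction of `P(df, dg)`. -/
def RestrictsBracket (P : Biv I M) (Z : Vec I M) (ι : N → M) (Λ : Biv I' N) (V : Vec I' N) : Prop :=
  ∀ (U : Set M) (f g : M → ℝ), IsOpen U →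
    ContMDiffOn I 𝓘(ℝ, ℝ) ∞ f U → ContMDiffOn I 𝓘(ℝ, ℝ) ∞ g U →
    (∀ x ∈ U, mvfderiv I f x (Z x) = f x) → (∀ x ∈ U, mvfderiv I g x (Z x) = g x) →
    ∀ y : N, ι y ∈ U →
      bracket I' Λ V (f ∘ ι) (g ∘ ι) y = mvfderiv I g (ι y) (P (ι y) (mvfderiv I f (ι y)))

end Definitions

end JacobiNijenhuis

/-! Everything is tested on differentials of functions. The Jacobi identity for `(Λ, V)` is
equivalent to two identities between vector fields (`isJacobi_iff_rel`): `SchoutenRel`, which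
computes `[Λdf, Λdg]`, and `InvariantRel`, which says `[V, Λdf] = Λ d(Vf)`.

For the hierarchy on `M`, vanishing torsion expresses `[JX, JY]` through brackets in which at most
one entry carries `J`. Hence `SchoutenRel` passes from `(Λ, V)` to `(JΛ, JV)` up to the concomitant,
and condition (ii) is exactly what cancels the remainder (`SchoutenRel.comp_endo`). In its dual form
the concomitant of `JΛ` is `J` applied to that of `Λ` (`dualConcomitant_comp`), so (ii) is inherited
and the induction runs. Invariance is not inductive: it follows from (iii) for each `k` separately.
Each resulting Jacobi structure is Poissonized to `e⁻ᵗ (Λ + ∂ₜ ∧ V)`. The map `f ↦ eᵗ f` intertwines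
the two brackets, and at a point every covector is the differential of some `eᵗ f`; since the
Jacobiator of a bivector is tensorial, these functions suffice to test it. The Nijenhuis tensor on
`M × ℝ` is the identity.

For the converse, the same induction with `V = 0` shows that every `J^k P` is Poisson. Vanishing of
the concomitant with the powers of `J` gives vanishing mixed Schouten brackets (`mixedRel_power`),
so differences are Poisson too, and homogeneity is inherited (`lieSharp_power`). Along `N` the
tangent space of `M` is `TN ⊕ ℝZ`, which gives the decomposition and its uniqueness by linear
algebra. The bracket on `N` is the restriction of `Q(dF, dG)` to functions with `ZF = F`. For the
Jacobi identity at one point it is enough to extend functions so that `ZF - F` vanishes on `N` near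
the point and has zero differential there (`exists_homogeneous_extension`). Decomposition and
homogeneity are linear in the bivector, so `DecomposesAlong.isJacobi`, applied to a pencil upstairs,
gives compatibility downstairs. -/

namespace JacobiNijenhuis

open Set Filter Topology VectorField

set_option linter.unusedSectionVars false

/-! ### Germs, differentials, smoothness tests and the Lie bracket as a commutator -/

section Toolkit

variable {E : Type*} [NormedAddCommGroup E] [NormedSpace ℝ E] [FiniteDimensional ℝ E]
  {H : Type*} [TopologicalSpace H] {I : ModelWithCorners ℝ E H}
  {M : Type*} [TopologicalSpace M] [ChartedSpace H M]

/-! ### Smooth functions and their differentials -/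

/-- The germ of a smooth function is the germ of a globally smooth function. -/
lemma exists_smoothFun_eventuallyEq [IsManifold I ∞ M] [T2Space M] {u : M → ℝ} {x : M}
    (hu : ∀ᶠ y in 𝓝 x, ContMDiffAt I 𝓘(ℝ, ℝ) ∞ u y) :
    ∃ v : M → ℝ, SmoothFun I v ∧ v =ᶠ[𝓝 x] u := by
  obtain ⟨φ, -, hφ⟩ := (SmoothBumpFunction.nhds_basis_tsupport (I := I) x).mem_iff.1 hu
  refine ⟨fun y => φ y • u y, ?_, ?_⟩
  · refine contMDiff_of_tsupport fun y hy => ?_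
    exact φ.contMDiffAt.smul (hφ (tsupport_smul_subset_left _ _ hy))
  · filter_upwards [φ.eventuallyEq_one] with y hy
    simp [hy]

lemma SmoothFun.mdifferentiableAt {f : M → ℝ} (hf : SmoothFun I f) (x : M) :
    MDifferentiableAt I 𝓘(ℝ, ℝ) f x :=
  (hf x).mdifferentiableAt (by simp)

lemma mvfderiv_congr {f g : M → ℝ} {x : M} (h : f =ᶠ[𝓝 x] g) :
    mvfderiv I f x = mvfderiv I g x := by
  have h1 := h.mfderiv_eq (I := I) (I' := 𝓘(ℝ, ℝ))
  have h2 := h.eq_of_nhds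
  simp only [mvfderiv]
  ext v
  exact congrArg (fun L : E →L[ℝ] ℝ => L v) h1

/-- Every covector is the differential of a smooth function. -/
lemma exists_smoothFun_mvfderiv_eq [IsManifold I ∞ M] [T2Space M] (x : M)
    (a : TangentSpace I x →L[ℝ] ℝ) :
    ∃ f : M → ℝ, SmoothFun I f ∧ mvfderiv I f x = a := by
  obtain ⟨A, hA⟩ := isInvertible_mfderiv_extChartAt (I := I) (mem_extChartAt_source (I := I) x)
  let b : E →L[ℝ] ℝ := a.comp A.symm.toContinuousLinearMap
  have hu : ∀ᶠ y in 𝓝 x, ContMDiffAt I 𝓘(ℝ, ℝ) ∞ (b ∘ extChartAt I x) y := by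
    filter_upwards [chart_source_mem_nhds H x] with y hy
    exact b.contMDiff.contMDiffAt.comp y (contMDiffAt_extChartAt' hy)
  obtain ⟨v, hv, hvu⟩ := exists_smoothFun_eventuallyEq hu
  refine ⟨v, hv, ?_⟩
  rw [mvfderiv_congr hvu]
  ext w
  have h1 : MDifferentiableAt I 𝓘(ℝ, E) (extChartAt I x) x :=
    mdifferentiableAt_extChartAt (mem_chart_source H x)
  have h2 : MDifferentiableAt 𝓘(ℝ, E) 𝓘(ℝ, ℝ) b (extChartAt I x x) :=
    b.contMDiff.contMDiffAt.mdifferentiableAt (n := ∞) (by simp)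
  have h3 := mfderiv_comp x h2 h1
  rw [ContinuousLinearMap.mfderiv_eq, ← hA] at h3
  have h4 : mvfderiv I (b ∘ extChartAt I x) x w = b (A w) :=
    congrArg (fun L : E →L[ℝ] ℝ => L w) h3
  rw [h4]
  change a (A.symm (A w)) = a w
  rw [A.symm_apply_apply]

/-- Tangent vectors are separated by the differentials of smooth functions. -/
lemma tangent_ext [IsManifold I ∞ M] [T2Space M] {x : M} {v w : TangentSpace I x}
    (h : ∀ f : M → ℝ, SmoothFun I f → mvfderiv I f x v = mvfderiv I f x w) : v = w := by
  have h' : ∀ a : E →L[ℝ] ℝ, a v = a w := fun a => by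
    obtain ⟨f, hf, hfa⟩ := exists_smoothFun_mvfderiv_eq (I := I) x a
    have := h f hf
    rwa [hfa] at this
  exact (SeparatingDual.eq_iff_forall_dual_eq (R := ℝ) (V := E)).2 h'

/-! ### Smoothness -/

lemma SmoothFun.smoothForm [IsManifold I ∞ M] {f : M → ℝ} (hf : SmoothFun I f) :
    SmoothForm I (mvfderiv I f) := by
  intro x
  rw [contMDiffAt_hom_bundle]
  refine ⟨contMDiffAt_id, ?_⟩
  have h := (hf x).mfderiv_const (m := ∞) (by simp)
  refine h.congr_of_eventuallyEq ?_
  filter_upwards with y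
  ext v
  simp [inTangentCoordinates, ContinuousLinearMap.inCoordinates, mvfderiv]
  rfl

lemma SmoothForm.smoothFun_apply [IsManifold I ∞ M] {α : Form I M} {X : Vec I M}
    (hα : SmoothForm I α) (hX : SmoothVec I X) : SmoothFun I (fun y => α y (X y)) := by
  intro x
  have h := ContMDiffAt.clm_bundle_apply (F₁ := E) (F₂ := ℝ)
      (E₁ := fun x : M => TangentSpace I x) (E₂ := Trivial M ℝ)
      (b := fun x => x) (ϕ := fun x => α x) (v := X) (hα x) (hX x)
  rw [contMDiffAt_totalSpace] at h
  exact h.2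

lemma SmoothFun.smoothFun_mvfderiv [IsManifold I ∞ M] {f : M → ℝ} {X : Vec I M}
    (hf : SmoothFun I f) (hX : SmoothVec I X) : SmoothFun I (fun y => mvfderiv I f y (X y)) :=
  hf.smoothForm.smoothFun_apply hX

lemma SmoothEndo.smoothVec_app [IsManifold I ∞ M] {J : Endo I M} {X : Vec I M}
    (hJ : SmoothEndo I J) (hX : SmoothVec I X) : SmoothVec I (app I J X) :=
  fun x => ContMDiffAt.clm_bundle_apply (F₁ := E) (F₂ := E)
      (E₁ := fun x : M => TangentSpace I x) (E₂ := fun x : M => TangentSpace I x)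
      (b := fun x => x) (ϕ := fun x => J x) (v := X) (hJ x) (hX x)

lemma IsBivector.smoothVec_sharp [IsManifold I ∞ M] {Λ : Biv I M} {α : Form I M}
    (hΛ : IsBivector I Λ) (hα : SmoothForm I α) : SmoothVec I (sharp I Λ α) :=
  fun x => ContMDiffAt.clm_bundle_apply (F₁ := E →L[ℝ] ℝ) (F₂ := E)
      (E₁ := fun x : M => TangentSpace I x →L[ℝ] Trivial M ℝ x)
      (E₂ := fun x : M => TangentSpace I x)
      (b := fun x => x) (ϕ := fun x => Λ x) (v := α) (hΛ.smooth x) (hα x)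

lemma SmoothEndo.smoothForm_transp [IsManifold I ∞ M] {J : Endo I M} {α : Form I M}
    (hJ : SmoothEndo I J) (hα : SmoothForm I α) : SmoothForm I (transp I J α) := by
  intro x
  have h1 := hα x
  have h2 := hJ x
  rw [contMDiffAt_hom_bundle] at h1 h2 ⊢
  refine ⟨contMDiffAt_id, (h1.2.clm_comp h2.2).congr_of_eventuallyEq ?_⟩
  filter_upwards [chart_source_mem_nhds H x] with y hy
  have hy' : y ∈ (trivializationAt E (TangentSpace I) x).baseSet := by simpa using hy
  ext v
  simp [ContinuousLinearMap.inCoordinates, transp]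
  congr 1
  exact ((trivializationAt E (TangentSpace I) x).symmL_continuousLinearMapAt hy' _).symm

lemma SmoothVec.mlieBracket [IsManifold I ∞ M] {X Y : Vec I M}
    (hX : SmoothVec I X) (hY : SmoothVec I Y) : SmoothVec I (mlieBracket I X Y) := by
  have : IsManifold I (((⊤ : ℕ∞) : WithTop ℕ∞) + 1) M := ‹IsManifold I ∞ M›
  have : IsManifold I (minSmoothness ℝ 2) M := by
    rw [minSmoothness_of_isRCLikeNormedField]
    exact IsManifold.of_le (n := ∞) (WithTop.coe_le_coe.2 le_top)
  exact ContDiff.mlieBracket_vectorField (m := ⊤) (n := ⊤) hX hY (by simp)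

lemma contMDiffAt_of_dual {V : Type*} [NormedAddCommGroup V] [NormedSpace ℝ V]
    [FiniteDimensional ℝ V] {u : M → V} {x : M}
    (h : ∀ β : V →L[ℝ] ℝ, ContMDiffAt I 𝓘(ℝ, ℝ) ∞ (fun y => β (u y)) x) :
    ContMDiffAt I 𝓘(ℝ, V) ∞ u x := by
  let e := (Module.finBasis ℝ V).equivFunL
  have h1 : ContMDiffAt I 𝓘(ℝ, Fin (Module.finrank ℝ V) → ℝ) ∞ (fun y => e (u y)) x :=
    contMDiffAt_pi_space.2 fun i => h ((ContinuousLinearMap.proj i).comp e.toContinuousLinearMap)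
  have h2 := (e.symm.toContinuousLinearMap.contMDiff.contMDiffAt).comp x h1
  refine h2.congr_of_eventuallyEq (.of_forall fun y => ?_)
  exact (e.symm_apply_apply _).symm

lemma contMDiffAt_clm_of_apply {V W : Type*} [NormedAddCommGroup V] [NormedSpace ℝ V]
    [NormedAddCommGroup W] [NormedSpace ℝ W] [FiniteDimensional ℝ W]
    {u : M → W →L[ℝ] V} {x : M}
    (h : ∀ w, ContMDiffAt I 𝓘(ℝ, V) ∞ (fun y => u y w) x) :
    ContMDiffAt I 𝓘(ℝ, W →L[ℝ] V) ∞ u x := by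
  let b := Module.finBasis ℝ W
  have e : u = fun y => ∑ i, ContinuousLinearMap.smulRightL ℝ W V (b.coord i).toContinuousLinearMap
      (u y (b i)) := by
    ext y w
    simp only [_root_.sum_apply, ContinuousLinearMap.smulRightL_apply_apply,
      LinearMap.coe_toContinuousLinearMap', Module.Basis.coord_apply,
      ContinuousLinearMap.smulRight_apply]
    conv_lhs => rw [← b.sum_repr w]
    simp only [map_sum, map_smul]
  rw [e]
  exact contMDiffAt_finsetSum fun i _ =>
    (ContinuousLinearMap.contMDiff _).contMDiffAt.comp x (h (b i))

/-- The differential of a coordinate function of the chart at `x`. -/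
lemma mvfderiv_comp_extChartAt [IsManifold I ∞ M] (β : E →L[ℝ] ℝ) {x y : M}
    (hy : y ∈ (chartAt H x).source) :
    mvfderiv I (β ∘ extChartAt I x) y =
      β.comp ((trivializationAt E (TangentSpace I) x).continuousLinearMapAt ℝ y) := by
  have h1 : MDifferentiableAt I 𝓘(ℝ, E) (extChartAt I x) y := mdifferentiableAt_extChartAt hy
  have h2 : MDifferentiableAt 𝓘(ℝ, E) 𝓘(ℝ, ℝ) β (extChartAt I x y) :=
    β.contMDiff.contMDiffAt.mdifferentiableAt (n := ∞) (by simp)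
  have h3 := mfderiv_comp y h2 h1
  have : IsManifold I 1 M := IsManifold.of_le (n := ∞) (by simp)
  rw [ContinuousLinearMap.mfderiv_eq,
    ← TangentBundle.continuousLinearMapAt_trivializationAt hy] at h3
  ext v
  exact congrArg (fun L : E →L[ℝ] ℝ => L v) h3

/-- A vector field is smooth if it maps coordinate functions to smooth functions. -/
lemma smoothVec_of_coord [IsManifold I ∞ M] {X : Vec I M}
    (h : ∀ (x : M) (β : E →L[ℝ] ℝ), ContMDiffAt I 𝓘(ℝ, ℝ) ∞
      (fun y => mvfderiv I (β ∘ extChartAt I x) y (X y)) x) : SmoothVec I X := by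
  intro x
  rw [contMDiffAt_totalSpace]
  refine ⟨contMDiffAt_id, contMDiffAt_of_dual fun β => (h x β).congr_of_eventuallyEq ?_⟩
  filter_upwards [chart_source_mem_nhds H x] with y hy
  rw [mvfderiv_comp_extChartAt β hy]
  have hy' : y ∈ (trivializationAt E (TangentSpace I) x).baseSet := by simpa using hy
  refine congrArg β (Eq.symm ?_)
  exact congrFun (Trivialization.coe_linearMapAt_of_mem (R := ℝ) _ hy') (X y)

/-- A skew-symmetric bivector is smooth if it maps coordinate functions to smooth functions. -/
lemma isBivector_of_coord [IsManifold I ∞ M] {Λ : Biv I M}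
    (hs : ∀ (x : M) (a b : TangentSpace I x →L[ℝ] ℝ), b (Λ x a) = - a (Λ x b))
    (h : ∀ (x : M) (α β : E →L[ℝ] ℝ), ContMDiffAt I 𝓘(ℝ, ℝ) ∞
      (fun y => mvfderiv I (β ∘ extChartAt I x) y (Λ y (mvfderiv I (α ∘ extChartAt I x) y))) x) :
    IsBivector I Λ := by
  refine ⟨fun x => ?_, hs⟩
  rw [contMDiffAt_hom_bundle]
  refine ⟨contMDiffAt_id, contMDiffAt_clm_of_apply fun α => contMDiffAt_of_dual fun β =>
    (h x α β).congr_of_eventuallyEq ?_⟩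
  filter_upwards [chart_source_mem_nhds H x] with y hy
  rw [mvfderiv_comp_extChartAt β hy, mvfderiv_comp_extChartAt α hy]
  have hy' : y ∈ (trivializationAt E (TangentSpace I) x).baseSet := by simpa using hy
  -- The cotangent trivialization is dual to the tangent one: its inverse sends the constant
  -- covector `α` to the differential of the coordinate function `α ∘ extChartAt I x`.
  have e1 : (trivializationAt (E →L[ℝ] ℝ) (fun x : M => TangentSpace I x →L[ℝ] Trivial M ℝ x)
      x).symmL ℝ y α =
      α.comp ((trivializationAt E (TangentSpace I) x).continuousLinearMapAt ℝ y) := by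
    set e := trivializationAt (E →L[ℝ] ℝ)
      (fun x : M => TangentSpace I x →L[ℝ] Trivial M ℝ x) x
    have hye : y ∈ e.baseSet := ⟨hy', mem_univ _⟩
    have h1 : e.continuousLinearMapAt ℝ y
        (α.comp ((trivializationAt E (TangentSpace I) x).continuousLinearMapAt ℝ y)) = α := by
      have h2 := congrFun (Trivialization.coe_linearMapAt_of_mem (R := ℝ) _ hye)
        (α.comp ((trivializationAt E (TangentSpace I) x).continuousLinearMapAt ℝ y))
      refine h2.trans ?_
      ext v
      change ContinuousLinearMap.inCoordinates E (TangentSpace I) ℝ (Trivial M ℝ) x y x y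
        (α.comp ((trivializationAt E (TangentSpace I) x).continuousLinearMapAt ℝ y)) v = α v
      have tr : (trivializationAt ℝ (Trivial M ℝ) x).continuousLinearMapAt ℝ y =
          ContinuousLinearMap.id ℝ ℝ := Trivial.continuousLinearMapAt_trivialization _ _ _ _
      rw [ContinuousLinearMap.inCoordinates, tr]
      exact congrArg α (Trivialization.continuousLinearMapAt_symmL (R := ℝ) _ hy' v)
    have h3 := Trivialization.symmL_continuousLinearMapAt e (R := ℝ) hye
        (α.comp ((trivializationAt E (TangentSpace I) x).continuousLinearMapAt ℝ y))
    rwa [h1] at h3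
  rw [ContinuousLinearMap.inCoordinates]
  simp only [ContinuousLinearMap.comp_apply]
  rw [e1]

/-- The bracket is defined by pulling both fields back to a chart. There each iterated derivative of
`f` is a Hessian term plus the derivative of `f` along the derivative of a field; the Hessian terms
cancel by symmetry. Without boundary the chart derivatives are ordinary ones. -/
lemma mvfderiv_mlieBracket [I.Boundaryless] [IsManifold I ∞ M] {f : M → ℝ} {X Y : Vec I M}
    (hf : SmoothFun I f) (hX : SmoothVec I X) (hY : SmoothVec I Y) (x : M) :
    mvfderiv I f x (mlieBracket I X Y x) =
      mvfderiv I (fun y => mvfderiv I f y (Y y)) x (X x)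
        - mvfderiv I (fun y => mvfderiv I f y (X y)) x (Y x) := by
  have : IsManifold I 1 M := IsManifold.of_le (n := ∞) (by simp)
  have : IsManifold I 2 M := IsManifold.of_le (n := ∞) (WithTop.coe_le_coe.2 le_top)
  set φ := extChartAt I x with hφ
  have hr : range I = univ := I.range_eq_univ
  have hsmooth : ∀ {g : M → ℝ}, SmoothFun I g → ∀ z ∈ φ.target,
      ContDiffAt ℝ ∞ (g ∘ φ.symm) z := by
    intro g hg z hz
    have h1 := (contMDiffOn_extChartAt_symm (I := I) (n := ∞) x z hz).contMDiffAt
      ((isOpen_extChartAt_target x).mem_nhds hz)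
    exact (ContMDiffAt.comp z (hg _) h1).contDiffAt
  set X' : E → E := mpullbackWithin 𝓘(ℝ, E) I φ.symm X (range I) with hX'
  set Y' : E → E := mpullbackWithin 𝓘(ℝ, E) I φ.symm Y (range I) with hY'
  have key : ∀ (g : M → ℝ) (W : Vec I M), SmoothFun I g → ∀ z ∈ φ.target,
      fderiv ℝ (g ∘ φ.symm) z (mpullbackWithin 𝓘(ℝ, E) I φ.symm W (range I) z) =
      mvfderiv I g (φ.symm z) (W (φ.symm z)) := by
    intro g W hg z hz
    have h1 := mdifferentiableWithinAt_extChartAt_symm (I := I) hz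
    have h2 := mfderiv_comp_mfderivWithin z (hg.mdifferentiableAt (φ.symm z)) h1
      (by rw [hr]; exact uniqueMDiffWithinAt_univ _)
    obtain ⟨A, hA⟩ := isInvertible_mfderivWithin_extChartAt_symm (I := I) hz
    rw [mpullbackWithin_apply, ← hA, ContinuousLinearMap.inverse_equiv]
    rw [← hA, hr, mfderivWithin_univ, mfderiv_eq_fderiv] at h2
    refine (congrArg (fun L : E →L[ℝ] ℝ => L (A.symm (W (φ.symm z)))) h2).trans ?_
    change mvfderiv I g (φ.symm z) (A (A.symm (W (φ.symm z)))) = _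
    rw [A.apply_symm_apply]
  have ht : φ.target ∈ 𝓝 (φ x) := extChartAt_target_mem_nhds x
  have hx : φ x ∈ φ.target := mem_extChartAt_target x
  have hxx : φ.symm (φ x) = x := extChartAt_to_inv x
  have hF := hsmooth hf _ hx
  have diff : ∀ W : Vec I M, SmoothVec I W →
      DifferentiableAt ℝ (mpullbackWithin 𝓘(ℝ, E) I φ.symm W (range I)) (φ x) := by
    intro W hW
    have h := MDifferentiableWithinAt.differentiableWithinAt_mpullbackWithin_vectorField
      (s := univ) (((hW x).mdifferentiableAt (by simp)).mdifferentiableWithinAt)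
    rw [preimage_univ, univ_inter, hr] at h
    rw [hr]
    exact differentiableWithinAt_univ.1 h
  -- Product rule for `z ↦ df(W')` in the chart.
  have second : ∀ W W' : Vec I M, SmoothVec I W → SmoothVec I W' →
      mvfderiv I (fun y => mvfderiv I f y (W' y)) x (W x) =
        fderiv ℝ (fderiv ℝ (f ∘ φ.symm)) (φ x)
          (mpullbackWithin 𝓘(ℝ, E) I φ.symm W (range I) (φ x))
          (mpullbackWithin 𝓘(ℝ, E) I φ.symm W' (range I) (φ x))
        + fderiv ℝ (f ∘ φ.symm) (φ x)
          (fderiv ℝ (mpullbackWithin 𝓘(ℝ, E) I φ.symm W' (range I)) (φ x)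
            (mpullbackWithin 𝓘(ℝ, E) I φ.symm W (range I) (φ x))) := by
    intro W W' hW hW'
    have h1 := key (fun y => mvfderiv I f y (W' y)) W (hf.smoothFun_mvfderiv hW') _ hx
    rw [hxx] at h1
    rw [← h1]
    have h2 : ((fun y => mvfderiv I f y (W' y)) ∘ φ.symm) =ᶠ[𝓝 (φ x)] fun z =>
        fderiv ℝ (f ∘ φ.symm) z (mpullbackWithin 𝓘(ℝ, E) I φ.symm W' (range I) z) := by
      filter_upwards [ht] with z hz using (key f W' hf z hz).symm
    rw [h2.fderiv_eq]
    have h3 : DifferentiableAt ℝ (fderiv ℝ (f ∘ φ.symm)) (φ x) :=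
      (hF.fderiv_right (m := 1) (WithTop.coe_le_coe.2 le_top)).differentiableAt (by simp)
    have h4 := (h3.hasFDerivAt.clm_apply (diff W' hW').hasFDerivAt).fderiv
    refine (congrArg (fun L : E →L[ℝ] ℝ =>
      L (mpullbackWithin 𝓘(ℝ, E) I φ.symm W (range I) (φ x))) h4).trans ?_
    exact add_comm _ _
  rw [second X Y hX hY, second Y X hY hX]
  have hsymm := (hF.of_le (n := ∞) (m := 2) (WithTop.coe_le_coe.2 le_top)).isSymmSndFDerivAt
    (by simp)
  rw [hsymm (X' (φ x)) (Y' (φ x))]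
  have hbr : mlieBracket I X Y x = (mfderiv I 𝓘(ℝ, E) φ x).inverse
      (fderiv ℝ Y' (φ x) (X' (φ x)) - fderiv ℝ X' (φ x) (Y' (φ x))) := by
    have hl : lieBracketWithin ℝ X' Y' (φ.symm ⁻¹' univ ∩ range I) (φ x) =
        fderiv ℝ Y' (φ x) (X' (φ x)) - fderiv ℝ X' (φ x) (Y' (φ x)) := by
      rw [preimage_univ, univ_inter, hr, lieBracketWithin_univ]
      rfl
    rw [← hl]
    rfl
  obtain ⟨A, hA⟩ := isInvertible_mfderiv_extChartAt (I := I) (mem_extChartAt_source (I := I) x)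
  have hcomp : mvfderiv I f x = (fderiv ℝ (f ∘ φ.symm) (φ x)).comp
      (A.toContinuousLinearMap : TangentSpace I x →L[ℝ] E) := by
    have h1 : f =ᶠ[𝓝 x] (f ∘ φ.symm) ∘ φ := by
      filter_upwards [extChartAt_source_mem_nhds (I := I) x] with y hy
      exact congrArg f (φ.left_inv hy).symm
    rw [mvfderiv_congr h1]
    have h3 := mfderiv_comp x (hF.differentiableAt (by simp)).mdifferentiableAt
      (mdifferentiableAt_extChartAt (mem_chart_source H x))
    rw [← hA, mfderiv_eq_fderiv] at h3
    ext v
    exact congrArg (fun L : E →L[ℝ] ℝ => L v) h3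
  rw [hbr, ← hA, ContinuousLinearMap.inverse_equiv, hcomp]
  have hA' := congrArg (fun v : E => fderiv ℝ (f ∘ φ.symm) (φ x) v) (A.apply_symm_apply
    (fderiv ℝ Y' (φ x) (X' (φ x)) - fderiv ℝ X' (φ x) (Y' (φ x)) : E))
  refine hA'.trans ((map_sub (fderiv ℝ (f ∘ φ.symm) (φ x)) _ _).trans ?_)
  ring

end Toolkit

/-! ### The Jacobi identity as relations between Hamiltonian vector fields -/

section Algebra

variable {E : Type*} [NormedAddCommGroup E] [NormedSpace ℝ E] [FiniteDimensional ℝ E]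
  {H : Type*} [TopologicalSpace H] {I : ModelWithCorners ℝ E H}
  {M : Type*} [TopologicalSpace M] [ChartedSpace H M] [IsManifold I ∞ M]

/-! ### Derivatives of combinations of smooth functions -/

lemma mvfderiv_fun_add {f g : M → ℝ} (hf : SmoothFun I f) (hg : SmoothFun I g) (x : M) :
    mvfderiv I (fun y => f y + g y) x = mvfderiv I f x + mvfderiv I g x :=
  mvfderiv_add (hf.mdifferentiableAt x) (hg.mdifferentiableAt x)

lemma mvfderiv_fun_sub {f g : M → ℝ} (hf : SmoothFun I f) (hg : SmoothFun I g) (x : M) :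
    mvfderiv I (fun y => f y - g y) x = mvfderiv I f x - mvfderiv I g x :=
  mvfderiv_sub (hf.mdifferentiableAt x) (hg.mdifferentiableAt x)

lemma mvfderiv_fun_mul {f g : M → ℝ} (hf : SmoothFun I f) (hg : SmoothFun I g) (x : M) :
    mvfderiv I (fun y => f y * g y) x = f x • mvfderiv I g x + g x • mvfderiv I f x :=
  mvfderiv_mul (hf.mdifferentiableAt x) (hg.mdifferentiableAt x)

lemma mvfderiv_fun_neg (f : M → ℝ) (x : M) :
    mvfderiv I (fun y => - f y) x = - mvfderiv I f x :=
  mvfderiv_neg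

lemma mvfderiv_fun_const (c : ℝ) (x : M) : mvfderiv I (fun _ : M => c) x = 0 :=
  mvfderiv_const c

lemma SmoothFun.add {f g : M → ℝ} (hf : SmoothFun I f) (hg : SmoothFun I g) :
    SmoothFun I (fun y => f y + g y) := ContMDiff.add hf hg

lemma SmoothFun.sub {f g : M → ℝ} (hf : SmoothFun I f) (hg : SmoothFun I g) :
    SmoothFun I (fun y => f y - g y) := ContMDiff.sub hf hg

lemma SmoothFun.mul {f g : M → ℝ} (hf : SmoothFun I f) (hg : SmoothFun I g) :
    SmoothFun I (fun y => f y * g y) := ContMDiff.mul hf hg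

lemma smoothFun_const (c : ℝ) : SmoothFun I (fun _ : M => c) := contMDiff_const

/-! ### Smoothness criteria -/

lemma eventually_contMDiffAt_comp_extChartAt (β : E →L[ℝ] ℝ) (x : M) :
    ∀ᶠ y in 𝓝 x, ContMDiffAt I 𝓘(ℝ, ℝ) ∞ (β ∘ extChartAt I x) y := by
  filter_upwards [chart_source_mem_nhds H x] with y hy
  exact β.contMDiff.contMDiffAt.comp y (contMDiffAt_extChartAt' hy)

/-- Chart coordinates agree near each point with globally smooth functions, so global test functions
are enough. -/
lemma isBivector_of_smoothFun [T2Space M] {Λ : Biv I M}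
    (hs : ∀ (x : M) (a b : TangentSpace I x →L[ℝ] ℝ), b (Λ x a) = - a (Λ x b))
    (h : ∀ f g : M → ℝ, SmoothFun I f → SmoothFun I g →
      SmoothFun I (fun y => mvfderiv I g y (Λ y (mvfderiv I f y)))) : IsBivector I Λ := by
  refine isBivector_of_coord hs fun x α β => ?_
  obtain ⟨f, hf, hfα⟩ := exists_smoothFun_eventuallyEq
    (eventually_contMDiffAt_comp_extChartAt (I := I) α x)
  obtain ⟨g, hg, hgβ⟩ := exists_smoothFun_eventuallyEq
    (eventually_contMDiffAt_comp_extChartAt (I := I) β x)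
  refine (h f g hf hg x).congr_of_eventuallyEq ?_
  filter_upwards [hfα.eventuallyEq_nhds, hgβ.eventuallyEq_nhds] with y h1 h2
  rw [mvfderiv_congr h1, mvfderiv_congr h2]

lemma smoothVec_of_smoothFun [T2Space M] {X : Vec I M}
    (h : ∀ f : M → ℝ, SmoothFun I f → SmoothFun I (fun y => mvfderiv I f y (X y))) :
    SmoothVec I X := by
  refine smoothVec_of_coord fun x α => ?_
  obtain ⟨f, hf, hfα⟩ := exists_smoothFun_eventuallyEq
    (eventually_contMDiffAt_comp_extChartAt (I := I) α x)
  refine (h f hf x).congr_of_eventuallyEq ?_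
  filter_upwards [hfα.eventuallyEq_nhds] with y h1
  rw [mvfderiv_congr h1]

/-! ### Hamiltonian vector fields and the Jacobi identity -/

/-- The Hamiltonian vector field `Λ df`. -/
noncomputable def ham (Λ : Biv I M) (f : M → ℝ) : Vec I M := sharp I Λ (mvfderiv I f)

/-- The function `Λ(df, dg)`. -/
noncomputable def pb (Λ : Biv I M) (f g : M → ℝ) : M → ℝ := fun x => mvfderiv I g x (ham Λ f x)

/-- The function `X f`. -/
noncomputable def dir (X : Vec I M) (f : M → ℝ) : M → ℝ := fun x => mvfderiv I f x (X x)

variable {Λ : Biv I M} {V : Vec I M} {J : Endo I M}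

lemma IsBivector.smoothVec_ham (hΛ : IsBivector I Λ) {f : M → ℝ} (hf : SmoothFun I f) :
    SmoothVec I (ham Λ f) := hΛ.smoothVec_sharp hf.smoothForm

lemma SmoothFun.dir {X : Vec I M} {f : M → ℝ} (hf : SmoothFun I f) (hX : SmoothVec I X) :
    SmoothFun I (dir X f) := hf.smoothFun_mvfderiv hX

lemma IsBivector.smoothFun_pb (hΛ : IsBivector I Λ) {f g : M → ℝ} (hf : SmoothFun I f)
    (hg : SmoothFun I g) : SmoothFun I (pb Λ f g) := hg.dir (hΛ.smoothVec_ham hf)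

lemma IsBivector.pb_swap (hΛ : IsBivector I Λ) (f g : M → ℝ) : pb Λ f g = fun x => - pb Λ g f x :=
  funext fun x => hΛ.skew x _ _

lemma IsBivector.pb_swap_apply (hΛ : IsBivector I Λ) (f g : M → ℝ) (x : M) :
    mvfderiv I g x (ham Λ f x) = - mvfderiv I f x (ham Λ g x) := hΛ.skew x _ _

lemma dir_mlieBracket [I.Boundaryless] {f : M → ℝ} {X Y : Vec I M}
    (hf : SmoothFun I f) (hX : SmoothVec I X) (hY : SmoothVec I Y) (x : M) :
    mvfderiv I f x (mlieBracket I X Y x) =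
      mvfderiv I (dir Y f) x (X x) - mvfderiv I (dir X f) x (Y x) :=
  mvfderiv_mlieBracket hf hX hY x

lemma bracket_eq (f g : M → ℝ) :
    bracket I Λ V f g = fun x => pb Λ f g x + (f x * dir V g x - g x * dir V f x) := rfl

/-- The part of the Jacobiator that depends on differentials only. -/
noncomputable def schoutenTerm (Λ : Biv I M) (V : Vec I M) (f g h : M → ℝ) (x : M) : ℝ :=
  pb Λ f (pb Λ g h) x + pb Λ g (pb Λ h f) x + pb Λ h (pb Λ f g) x
    + dir V f x * pb Λ g h x + dir V g x * pb Λ h f x + dir V h x * pb Λ f g x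

/-- The function `[V, Λ](df, dg)`. -/
noncomputable def invTerm (Λ : Biv I M) (V : Vec I M) (f g : M → ℝ) (x : M) : ℝ :=
  dir V (pb Λ f g) x - pb Λ (dir V f) g x - pb Λ f (dir V g) x

lemma pb_bracket (hΛ : IsBivector I Λ) (hV : SmoothVec I V) {f g h : M → ℝ}
    (hg : SmoothFun I g) (hh : SmoothFun I h) (x : M) :
    pb Λ f (bracket I Λ V g h) x = pb Λ f (pb Λ g h) x + g x * pb Λ f (dir V h) x
      + dir V h x * pb Λ f g x - h x * pb Λ f (dir V g) x - dir V g x * pb Λ f h x := by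
  rw [bracket_eq, pb]
  rw [mvfderiv_fun_add (hΛ.smoothFun_pb hg hh) ((hg.mul (hh.dir hV)).sub (hh.mul (hg.dir hV))),
    mvfderiv_fun_sub (hg.mul (hh.dir hV)) (hh.mul (hg.dir hV)),
    mvfderiv_fun_mul hg (hh.dir hV), mvfderiv_fun_mul hh (hg.dir hV)]
  simp [dir, pb]
  ring

lemma dir_bracket (hΛ : IsBivector I Λ) (hV : SmoothVec I V) {f g : M → ℝ}
    (hf : SmoothFun I f) (hg : SmoothFun I g) (x : M) :
    dir V (bracket I Λ V f g) x =
      dir V (pb Λ f g) x + f x * dir V (dir V g) x - g x * dir V (dir V f) x := by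
  rw [bracket_eq, dir]
  rw [mvfderiv_fun_add (hΛ.smoothFun_pb hf hg) ((hf.mul (hg.dir hV)).sub (hg.mul (hf.dir hV))),
    mvfderiv_fun_sub (hf.mul (hg.dir hV)) (hg.mul (hf.dir hV)),
    mvfderiv_fun_mul hf (hg.dir hV), mvfderiv_fun_mul hg (hf.dir hV)]
  simp [dir]
  ring

/-- This separates the two components of the Jacobi condition: the term free of undifferentiated
functions carries the Schouten bracket of `Λ` with itself together with `V ∧ Λ`, and the
coefficients of `f`, `g`, `h` carry `[V, Λ]`. Second derivatives along `V` cancel in the cyclic sum.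
-/
lemma jacobiator_eq (hΛ : IsBivector I Λ) (hV : SmoothVec I V) {f g h : M → ℝ}
    (hf : SmoothFun I f) (hg : SmoothFun I g) (hh : SmoothFun I h) (x : M) :
    bracket I Λ V f (bracket I Λ V g h) x + bracket I Λ V g (bracket I Λ V h f) x
      + bracket I Λ V h (bracket I Λ V f g) x =
    schoutenTerm Λ V f g h x + f x * invTerm Λ V g h x + g x * invTerm Λ V h f x
      + h x * invTerm Λ V f g x := by
  have e : ∀ u v : M → ℝ, bracket I Λ V u v x =
    pb Λ u v x + (u x * dir V v x - v x * dir V u x) := fun _ _ => rfl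
  rw [e f, e g (bracket I Λ V h f), e h (bracket I Λ V f g)]
  rw [pb_bracket hΛ hV hg hh, pb_bracket hΛ hV hh hf, pb_bracket hΛ hV hf hg,
    dir_bracket hΛ hV hg hh, dir_bracket hΛ hV hh hf, dir_bracket hΛ hV hf hg]
  simp only [schoutenTerm, invTerm, bracket_eq]
  have s1 := congrFun (hΛ.pb_swap g f) x
  have s2 := congrFun (hΛ.pb_swap h f) x
  have s3 := congrFun (hΛ.pb_swap h g) x
  have t1 := congrFun (hΛ.pb_swap f (dir V h)) x
  have t2 := congrFun (hΛ.pb_swap f (dir V g)) x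
  have t3 := congrFun (hΛ.pb_swap g (dir V h)) x
  have t4 := congrFun (hΛ.pb_swap g (dir V f)) x
  have t5 := congrFun (hΛ.pb_swap h (dir V g)) x
  have t6 := congrFun (hΛ.pb_swap h (dir V f)) x
  simp only [s1, s2, s3, t1, t2, t3, t4, t5, t6]
  ring

lemma isJacobi_iff : IsJacobi I Λ V ↔ IsBivector I Λ ∧ SmoothVec I V ∧
    (∀ f g h : M → ℝ, SmoothFun I f → SmoothFun I g → SmoothFun I h → ∀ x,
      schoutenTerm Λ V f g h x = 0) ∧
    (∀ f g : M → ℝ, SmoothFun I f → SmoothFun I g → ∀ x, invTerm Λ V f g x = 0) := by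
  constructor
  · intro hJ
    have hΛ := hJ.isBivector
    have hV := hJ.smoothVec
    have inv : ∀ f g : M → ℝ, SmoothFun I f → SmoothFun I g → ∀ x, invTerm Λ V f g x = 0 := by
      intro f g hf hg x
      -- Inserting the constant `1` kills every term containing its differential and isolates the
      -- coefficient `invTerm Λ V f g`.
      have h1 : SmoothFun I (fun _ : M => (1 : ℝ)) := smoothFun_const 1
      have h := hJ.jacobi _ f g h1 hf hg x
      rw [jacobiator_eq hΛ hV h1 hf hg] at h
      have z1 : ∀ u, pb Λ (fun _ => (1 : ℝ)) u = fun _ => 0 := fun u => by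
        ext y; simp [pb, ham, sharp, mvfderiv_fun_const]
      have z2 : ∀ u, pb Λ u (fun _ => (1 : ℝ)) = fun _ => 0 := fun u => by
        ext y; simp [pb, mvfderiv_fun_const]
      have z3 : dir V (fun _ => (1 : ℝ)) = fun _ => 0 := by
        ext y; simp [dir, mvfderiv_fun_const]
      have z4 : ∀ u, pb Λ (fun _ => (0 : ℝ)) u = fun _ => 0 := fun u => by
        ext y; simp [pb, ham, sharp, mvfderiv_fun_const]
      have z5 : ∀ u, pb Λ u (fun _ => (0 : ℝ)) = fun _ => 0 := fun u => by
        ext y; simp [pb, mvfderiv_fun_const]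
      have z6 : dir V (fun _ => (0 : ℝ)) = fun _ => 0 := by
        ext y; simp [dir, mvfderiv_fun_const]
      simpa [schoutenTerm, invTerm, z1, z2, z3, z4, z5, z6] using h
    refine ⟨hΛ, hV, fun f g h hf hg hh x => ?_, inv⟩
    have := hJ.jacobi f g h hf hg hh x
    rw [jacobiator_eq hΛ hV hf hg hh, inv g h hg hh, inv h f hh hf, inv f g hf hg] at this
    simpa using this
  · rintro ⟨hΛ, hV, hS, inv⟩
    refine ⟨hΛ, hV, fun f g h hf hg hh x => ?_⟩
    rw [jacobiator_eq hΛ hV hf hg hh, inv g h hg hh, inv h f hh hf, inv f g hf hg,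
      hS f g h hf hg hh]
    simp

/-- `[Λdf, Λdg] = Λ d(Λ(df, dg)) - (Vf Λdg - Vg Λdf + Λ(df, dg) V)`. -/
def SchoutenRel (Λ : Biv I M) (V : Vec I M) : Prop :=
  ∀ f g : M → ℝ, SmoothFun I f → SmoothFun I g → ∀ x,
    mlieBracket I (ham Λ f) (ham Λ g) x = ham Λ (pb Λ f g) x
      - (dir V f x • ham Λ g x - dir V g x • ham Λ f x + pb Λ f g x • V x)

/-- `[V, Λdf] = Λ d(Vf)`. -/
def InvariantRel (Λ : Biv I M) (V : Vec I M) : Prop :=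
  ∀ f : M → ℝ, SmoothFun I f → ∀ x, mlieBracket I V (ham Λ f) x = ham Λ (dir V f) x

lemma pb_neg_right (f g : M → ℝ) (x : M) : pb Λ f (fun y => - g y) x = - pb Λ f g x := by
  simp [pb, mvfderiv_fun_neg]

lemma dir_mlieBracket_ham [I.Boundaryless] (hΛ : IsBivector I Λ) {f g h : M → ℝ}
    (hf : SmoothFun I f) (hg : SmoothFun I g) (hh : SmoothFun I h) (x : M) :
    mvfderiv I h x (mlieBracket I (ham Λ f) (ham Λ g) x) =
      pb Λ f (pb Λ g h) x + pb Λ g (pb Λ h f) x := by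
  rw [dir_mlieBracket hh (hΛ.smoothVec_ham hf) (hΛ.smoothVec_ham hg)]
  have e := pb_neg_right (Λ := Λ) g (pb Λ f h) x
  rw [hΛ.pb_swap h f, e]
  rfl

/-- Pairing the vector identity with `dh` gives `schoutenTerm`; conversely, differentials of
functions separate tangent vectors. -/
lemma schoutenRel_iff [I.Boundaryless] [T2Space M] (hΛ : IsBivector I Λ) :
    SchoutenRel Λ V ↔ ∀ f g h : M → ℝ, SmoothFun I f → SmoothFun I g → SmoothFun I h → ∀ x,
      schoutenTerm Λ V f g h x = 0 := by
  have key : ∀ f g h : M → ℝ, SmoothFun I f → SmoothFun I g → SmoothFun I h → ∀ x,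
      schoutenTerm Λ V f g h x = mvfderiv I h x (mlieBracket I (ham Λ f) (ham Λ g) x) -
      mvfderiv I h x (ham Λ (pb Λ f g) x
      - (dir V f x • ham Λ g x - dir V g x • ham Λ f x + pb Λ f g x • V x)) := by
    intro f g h hf hg hh x
    rw [dir_mlieBracket_ham hΛ hf hg hh]
    have s1 := congrFun (hΛ.pb_swap h (pb Λ f g)) x
    have s2 := congrFun (hΛ.pb_swap h f) x
    simp only [map_sub, map_add, map_smul, smul_eq_mul]
    change schoutenTerm Λ V f g h x = pb Λ f (pb Λ g h) x + pb Λ g (pb Λ h f) x -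
      (pb Λ (pb Λ f g) h x -
      (dir V f x * pb Λ g h x - dir V g x * pb Λ f h x + pb Λ f g x * dir V h x))
    simp only [schoutenTerm]
    rw [s1, s2]
    ring
  constructor
  · intro hS f g h hf hg hh x
    rw [key f g h hf hg hh, hS f g hf hg, sub_self]
  · intro hS f g hf hg x
    refine tangent_ext fun h hh => ?_
    exact sub_eq_zero.1 ((key f g h hf hg hh x).symm.trans (hS f g h hf hg hh x))

lemma invariantRel_iff [I.Boundaryless] [T2Space M] (hΛ : IsBivector I Λ) (hV : SmoothVec I V) :
    InvariantRel Λ V ↔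
      ∀ f g : M → ℝ, SmoothFun I f → SmoothFun I g → ∀ x, invTerm Λ V f g x = 0 := by
  have key : ∀ f g : M → ℝ, SmoothFun I f → SmoothFun I g → ∀ x,
      invTerm Λ V f g x = mvfderiv I g x (mlieBracket I V (ham Λ f) x) -
        mvfderiv I g x (ham Λ (dir V f) x) := by
    intro f g hf hg x
    rw [dir_mlieBracket hg hV (hΛ.smoothVec_ham hf)]
    simp only [invTerm]
    change _ = dir V (pb Λ f g) x - pb Λ f (dir V g) x - pb Λ (dir V f) g x
    ring
  constructor
  · intro hS f g hf hg x
    rw [key f g hf hg, hS f hf, sub_self]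
  · intro hS f hf x
    refine tangent_ext fun g hg => ?_
    exact sub_eq_zero.1 ((key f g hf hg x).symm.trans (hS f g hf hg x))

lemma isJacobi_iff_rel [I.Boundaryless] [T2Space M] : IsJacobi I Λ V ↔
    IsBivector I Λ ∧ SmoothVec I V ∧ SchoutenRel Λ V ∧ InvariantRel Λ V := by
  rw [isJacobi_iff]
  constructor
  · rintro ⟨hΛ, hV, hS, hi⟩
    exact ⟨hΛ, hV, (schoutenRel_iff hΛ).2 hS, (invariantRel_iff hΛ hV).2 hi⟩
  · rintro ⟨hΛ, hV, hS, hi⟩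
    exact ⟨hΛ, hV, (schoutenRel_iff hΛ).1 hS, (invariantRel_iff hΛ hV).1 hi⟩

end Algebra

/-! ### The hierarchy `(J^k Λ, J^k V)` of a compatible Nijenhuis tensor -/

section Hierarchy

variable {E : Type*} [NormedAddCommGroup E] [NormedSpace ℝ E] [FiniteDimensional ℝ E]
  {H : Type*} [TopologicalSpace H] {I : ModelWithCorners ℝ E H} [I.Boundaryless]
  {M : Type*} [TopologicalSpace M] [ChartedSpace H M] [IsManifold I ∞ M] [T2Space M]
  {Λ : Biv I M} {V : Vec I M} {J : Endo I M}

/-! ### Lie derivatives of bivector fields -/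

lemma dir_def (X : Vec I M) (f : M → ℝ) : dir X f = fun x => mvfderiv I f x (X x) := rfl

lemma pair_def (Λ : Biv I M) (α β : Form I M) : pair I Λ α β = fun x => β x (sharp I Λ α x) := rfl

/-- The vector field `(L_X Λ) α = [X, Λ α] - Λ (L_X α)`. -/
noncomputable def lieSharp (X : Vec I M) (Λ : Biv I M) (α : Form I M) : Vec I M := fun x =>
  mlieBracket I X (sharp I Λ α) x - Λ x (lieForm I X α x)

/-- This is `L_X df = d(Xf)` under `Λ`. Testing against `dg` moves `Λ` over by skewness, so that
`L_X df` is evaluated only on the smooth field `Λdg`, where `lieForm_apply` holds. -/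
lemma sharp_lieForm_mvfderiv (hΛ : IsBivector I Λ) {X : Vec I M} (hX : SmoothVec I X)
    {f : M → ℝ} (hf : SmoothFun I f) (x : M) :
    Λ x (lieForm I X (mvfderiv I f) x) = ham Λ (dir X f) x := by
  refine tangent_ext fun g hg => ?_
  rw [hΛ.skew, hΛ.pb_swap_apply]
  have h := lieForm_apply I (X := X) hf.smoothForm (hΛ.smoothVec_ham hg) x
  have h' := dir_mlieBracket hf hX (hΛ.smoothVec_ham hg) x
  change - lieForm I X (mvfderiv I f) x (ham Λ g x) = _
  rw [h, h']
  simp only [dir_def]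
  ring

lemma lieSharp_mvfderiv (hΛ : IsBivector I Λ) {X : Vec I M} (hX : SmoothVec I X)
    {f : M → ℝ} (hf : SmoothFun I f) (x : M) :
    lieSharp X Λ (mvfderiv I f) x = mlieBracket I X (ham Λ f) x - ham Λ (dir X f) x := by
  rw [lieSharp, sharp_lieForm_mvfderiv hΛ hX hf]
  rfl

/-- `L_X Λ` is skew-symmetric. -/
lemma lieSharp_skew (hΛ : IsBivector I Λ) {X : Vec I M} (hX : SmoothVec I X) {α : Form I M}
    (hα : SmoothForm I α) {g : M → ℝ} (hg : SmoothFun I g) (x : M) :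
    mvfderiv I g x (lieSharp X Λ α x) = - α x (lieSharp X Λ (mvfderiv I g) x) := by
  rw [lieSharp_mvfderiv hΛ hX hg]
  simp only [lieSharp, map_sub]
  rw [dir_mlieBracket hg hX (hΛ.smoothVec_sharp hα), hΛ.skew x (lieForm I X α x)]
  have h := lieForm_apply I (X := X) hα (hΛ.smoothVec_ham hg) x
  change _ - - lieForm I X α x (ham Λ g x) = _
  rw [h]
  have e1 : dir (sharp I Λ α) g = fun y => - α y (ham Λ g y) := funext fun y => hΛ.skew y _ _
  have e2 : mvfderiv I (dir X g) x (sharp I Λ α x) = - α x (ham Λ (dir X g) x) := hΛ.skew x _ _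
  rw [e1, e2, mvfderiv_fun_neg, _root_.neg_apply]
  ring

lemma lieBiv_eq (hΛ : IsBivector I Λ) (X : Vec I M) {α β : Form I M}
    (hα : SmoothForm I α) (hβ : SmoothForm I β) (x : M) :
    lieBiv I X Λ α β x = β x (lieSharp X Λ α x) := by
  have h := lieForm_apply I (X := X) hβ (hΛ.smoothVec_sharp hα) x
  simp only [lieBiv, lieSharp, map_sub]
  change _ - _ - lieForm I X β x (sharp I Λ α x) = _
  rw [h]
  simp only [pair_def, sharp]
  ring

/-- The Jacobi identity, for an arbitrary smooth 1-form in one of the arguments. -/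
lemma SchoutenRel.mlieBracket_sharp (hS : SchoutenRel Λ V) (hΛ : IsBivector I Λ) {α : Form I M}
    (hα : SmoothForm I α) {f : M → ℝ} (hf : SmoothFun I f) (x : M) :
    mlieBracket I (ham Λ f) (sharp I Λ α) x = Λ x (lieForm I (ham Λ f) α x)
      - dir V f x • sharp I Λ α x + α x (V x) • ham Λ f x - α x (ham Λ f x) • V x := by
  refine tangent_ext fun g hg => ?_
  have hX := hΛ.smoothVec_ham hf
  -- Skewness of `L_X Λ` for `X = Λdf` exchanges `α` and `dg`; on the exact form `dg` the relation
  -- `hS` is available.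
  have h := lieSharp_skew hΛ hX hα hg x
  rw [lieSharp_mvfderiv hΛ hX hg, hS f g hf hg] at h
  have e : ham Λ (dir (ham Λ f) g) x = ham Λ (pb Λ f g) x := rfl
  have e2 : mvfderiv I g x (sharp I Λ α x) = - α x (ham Λ g x) := hΛ.skew x _ _
  simp only [lieSharp, map_sub, map_add, map_smul, smul_eq_mul, e] at h ⊢
  rw [e2]
  simp only [pb] at h
  simp only [dir] at h ⊢
  linear_combination h

/-! ### Nijenhuis tensors -/

lemma power_succ_apply (J : Endo I M) (k : ℕ) (x : M) (v : TangentSpace I x) :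
    power I J (k + 1) x v = J x (power I J k x v) := by
  simp only [power, pow_succ']
  rfl

lemma power_zero_apply (J : Endo I M) (x : M) (v : TangentSpace I x) :
    power I J 0 x v = v := by
  simp only [power, pow_zero]
  rfl

lemma power_succ_apply' (J : Endo I M) (k : ℕ) (x : M) (v : TangentSpace I x) :
    power I J (k + 1) x v = power I J k x (J x v) := by
  simp only [power, pow_succ]
  rfl

lemma power_add_apply (J : Endo I M) (k l : ℕ) (x : M) (v : TangentSpace I x) :
    power I J (k + l) x v = power I J k x (power I J l x v) := by
  simp only [power, pow_add]
  rfl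

lemma app_power_succ (J : Endo I M) (k : ℕ) (X : Vec I M) :
    app I (power I J (k + 1)) X = app I J (app I (power I J k) X) :=
  funext fun x => power_succ_apply J k x _

lemma app_power_zero (J : Endo I M) (X : Vec I M) : app I (power I J 0) X = X :=
  funext fun x => power_zero_apply J x _

lemma comp_power_succ (J : Endo I M) (k : ℕ) (Λ : Biv I M) :
    comp I (power I J (k + 1)) Λ = comp I J (comp I (power I J k) Λ) :=
  funext fun x => by ext1 a; exact power_succ_apply J k x _

lemma comp_power_zero (J : Endo I M) (Λ : Biv I M) : comp I (power I J 0) Λ = Λ :=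
  funext fun x => by ext1 a; exact power_zero_apply J x _

lemma transp_power_succ (J : Endo I M) (k : ℕ) (α : Form I M) :
    transp I (power I J (k + 1)) α = transp I J (transp I (power I J k) α) :=
  funext fun x => by ext1 v; exact congrArg (α x) (power_succ_apply' J k x v)

lemma transp_power_zero (J : Endo I M) (α : Form I M) : transp I (power I J 0) α = α :=
  funext fun x => by ext1 v; exact congrArg (α x) (power_zero_apply J x v)

lemma SmoothEndo.smoothVec_app_power (hJ : SmoothEndo I J) {X : Vec I M} (hX : SmoothVec I X)
    (k : ℕ) : SmoothVec I (app I (power I J k) X) := by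
  induction k with
  | zero => rwa [app_power_zero]
  | succ k ih => rw [app_power_succ]; exact hJ.smoothVec_app ih

lemma SmoothEndo.smoothForm_transp_power (hJ : SmoothEndo I J) {α : Form I M}
    (hα : SmoothForm I α) (k : ℕ) : SmoothForm I (transp I (power I J k) α) := by
  induction k with
  | zero => rwa [transp_power_zero]
  | succ k ih => rw [transp_power_succ]; exact hJ.smoothForm_transp ih

lemma IsNijenhuis.mlieBracket_app (hJ : IsNijenhuis I J) {X Y : Vec I M} (hX : SmoothVec I X)
    (hY : SmoothVec I Y) (x : M) :
    mlieBracket I (app I J X) (app I J Y) x = J x (mlieBracket I (app I J X) Y x)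
      + J x (mlieBracket I X (app I J Y) x) - J x (J x (mlieBracket I X Y x)) := by
  have h := hJ.torsion_eq_zero X Y hX hY x
  simp only [torsion] at h
  rw [← sub_eq_zero, ← h]
  abel

lemma IsNijenhuis.mlieBracket_app_power_left (hJ : IsNijenhuis I J) {X Y : Vec I M}
    (hX : SmoothVec I X) (hY : SmoothVec I Y) (k : ℕ) (x : M) :
    mlieBracket I (app I (power I J k) X) (app I J Y) x =
      J x (mlieBracket I (app I (power I J k) X) Y x)
      + power I J k x (mlieBracket I X (app I J Y) x)
      - power I J (k + 1) x (mlieBracket I X Y x) := by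
  induction k with
  | zero => simp only [app_power_zero, power_zero_apply, power_succ_apply]; abel
  | succ k ih =>
    rw [app_power_succ, hJ.mlieBracket_app (hJ.smooth.smoothVec_app_power hX k) hY, ih]
    simp only [map_sub, map_add, power_succ_apply]
    abel

/-- The mixed torsion of two powers of `J` vanishes. The induction on `l` rests on the case of a
single `J` in the second slot, itself an induction on `k`, and on commutation of powers. -/
lemma IsNijenhuis.mlieBracket_app_power (hJ : IsNijenhuis I J) {X Y : Vec I M}
    (hX : SmoothVec I X) (hY : SmoothVec I Y) (k l : ℕ) (x : M) :
    mlieBracket I (app I (power I J k) X) (app I (power I J l) Y) x =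
      power I J l x (mlieBracket I (app I (power I J k) X) Y x)
      + power I J k x (mlieBracket I X (app I (power I J l) Y) x)
      - power I J (k + l) x (mlieBracket I X Y x) := by
  induction l with
  | zero => simp only [app_power_zero, power_zero_apply, add_zero]; abel
  | succ l ih =>
    rw [app_power_succ,
      hJ.mlieBracket_app_power_left hX (hJ.smooth.smoothVec_app_power hY l), ih]
    rw [← add_assoc]
    simp only [map_sub, map_add, power_succ_apply]
    have : J x (power I J k x (mlieBracket I X (app I (power I J l) Y) x)) =
      power I J k x (J x (mlieBracket I X (app I (power I J l) Y) x)) := by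
      rw [← power_succ_apply, power_succ_apply']
    abel

lemma Commutes.comp_sharp (hc : Commutes I J Λ) (α : Form I M) :
    sharp I (comp I J Λ) α = sharp I Λ (transp I J α) :=
  funext fun x => hc x (α x)

lemma Commutes.comp_endo (hc : Commutes I J Λ) : Commutes I J (comp I J Λ) := fun x a =>
  congrArg (J x) (hc x a)

lemma IsBivector.comp_endo (hΛ : IsBivector I Λ) (hJ : SmoothEndo I J) (hc : Commutes I J Λ) :
    IsBivector I (comp I J Λ) := by
  refine isBivector_of_smoothFun (fun x a b => ?_) fun f g hf hg => ?_
  · have h1 := hc x b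
    change b (J x (Λ x a)) = - a (J x (Λ x b))
    rw [h1]
    exact hΛ.skew x a (b.comp (J x))
  · exact hg.dir (hJ.smoothVec_app (hΛ.smoothVec_ham hf))

/-! ### The concomitant of a bivector field and a Nijenhuis tensor -/

/-- The vector field `(L_{Λ α} J) X - Λ (L_X (ᵗJ α)) + Λ (L_{J X} α)`, which is dual to the
concomitant of `Λ` and `J`. -/
noncomputable def dualConcomitant (Λ : Biv I M) (J : Endo I M) (α : Form I M) (X : Vec I M) :
    Vec I M := fun x =>
  mlieBracket I (sharp I Λ α) (app I J X) x - J x (mlieBracket I (sharp I Λ α) X x)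
    - Λ x (lieForm I X (transp I J α) x) + Λ x (lieForm I (app I J X) α x)

/-- `{α, dg}_Λ = - L_{Λ dg} α` on vector fields. -/
lemma formBracket_mvfderiv_right (hΛ : IsBivector I Λ) {α : Form I M} (hα : SmoothForm I α)
    {g : M → ℝ} (hg : SmoothFun I g) {X : Vec I M} (hX : SmoothVec I X) (x : M) :
    formBracket I Λ α (mvfderiv I g) x (X x) = - lieForm I (ham Λ g) α x (X x) := by
  have h1 := lieForm_apply I (X := sharp I Λ α) hg.smoothForm hX x
  have h2 := dir_mlieBracket hg (hΛ.smoothVec_sharp hα) hX x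
  simp only [formBracket, _root_.sub_apply]
  rw [h1, h2, pair_def]
  change _ - lieForm I (ham Λ g) α x (X x) - _ = _
  simp only [dir_def]
  ring

/-- This moves from forms to vector fields, where the vanishing torsion can be used. All Lie
derivatives of forms are evaluated on smooth fields, and the commutation of `J` with `Λ` matches the
derivative terms on the two sides. -/
lemma concomitant_apply (hΛ : IsBivector I Λ) (hJ : SmoothEndo I J) (hc : Commutes I J Λ)
    {α : Form I M} (hα : SmoothForm I α) {g : M → ℝ} (hg : SmoothFun I g) {X : Vec I M}
    (hX : SmoothVec I X) (x : M) :
    concomitant I Λ J α (mvfderiv I g) x (X x) =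
      - mvfderiv I g x (dualConcomitant Λ J α X x) := by
  have hJX := hJ.smoothVec_app hX
  have hJα := hJ.smoothForm_transp hα
  have hJg := hJ.smoothForm_transp hg.smoothForm
  have hg' := hΛ.smoothVec_ham hg
  have hα' := hΛ.smoothVec_sharp hα
  have a1 := formBracket_mvfderiv_right (hΛ.comp_endo hJ hc) hα hg hX x
  have a2 := formBracket_mvfderiv_right hΛ hJα hg hX x
  have a3 := formBracket_mvfderiv_right hΛ hα hg hJX x
  have b1 := lieForm_apply I (X := ham (comp I J Λ) g) hα hX x
  have b2 := lieForm_apply I (X := ham Λ g) hJα hX x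
  have b3 := lieForm_apply I (X := ham Λ g) hα hJX x
  have b4 := lieForm_apply I (X := sharp I Λ α) hJg hX x
  have b5 := lieForm_apply I (X := sharp I Λ (transp I J (mvfderiv I g))) hα hX x
  have b6 := lieForm_apply I (X := X) hJα hg' x
  have b7 := lieForm_apply I (X := app I J X) hα hg' x
  have c1 := dir_mlieBracket hg hα' hJX x
  have hsh : sharp I Λ (transp I J (mvfderiv I g)) = ham (comp I J Λ) g :=
    (hc.comp_sharp _).symm
  have hsk1 : (fun y => α y (ham Λ g y)) = fun y => - dir (sharp I Λ α) g y :=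
    funext fun y => by rw [eq_neg_iff_add_eq_zero, add_comm, ← eq_neg_iff_add_eq_zero]
                       exact hΛ.skew y _ _
  have hsk2 : (fun y => transp I J α y (ham Λ g y)) =
      fun y => - pair I Λ α (transp I J (mvfderiv I g)) y := by
    funext y
    change α y (J y (Λ y (mvfderiv I g y))) =
      - (mvfderiv I g y) (J y (Λ y (α y)))
    rw [hc y (mvfderiv I g y)]
    exact hΛ.skew y _ _
  rw [hsh] at b5
  rw [hsk1, mvfderiv_fun_neg] at b7
  rw [hsk2, mvfderiv_fun_neg] at b6
  have s1 := mlieBracket_swap_apply (I := I) (V := X) (W := ham Λ g) (x := x)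
  have s2 := mlieBracket_swap_apply (I := I) (V := app I J X) (W := ham Λ g) (x := x)
  have e0 : concomitant I Λ J α (mvfderiv I g) x (X x) =
    formBracket I (comp I J Λ) α (mvfderiv I g) x (X x)
    - (formBracket I Λ (transp I J α) (mvfderiv I g) x (X x)
      + (lieForm I (sharp I Λ α) (transp I J (mvfderiv I g)) x (X x)
        - lieForm I (sharp I Λ (transp I J (mvfderiv I g))) α x (X x)
        - mvfderiv I (pair I Λ α (transp I J (mvfderiv I g))) x (X x))
      - formBracket I Λ α (mvfderiv I g) x (app I J X x)) := rfl
  rw [e0, a1, a2, a3, hsh, b1, b2, b3, b4]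
  simp only [dualConcomitant, map_sub, map_add]
  rw [hΛ.skew x (lieForm I X (transp I J α) x), hΛ.skew x (lieForm I (app I J X) α x), c1]
  change _ = - (_ - _ - (- lieForm I X (transp I J α) x (ham Λ g x)) +
    (- lieForm I (app I J X) α x (ham Λ g x)))
  rw [b6, b7, s1, s2]
  simp only [map_neg, _root_.neg_apply]
  simp only [transp, dir_def, app, ContinuousLinearMap.comp_apply]
  ring

/-- The concomitant of `J Λ` and `J` in terms of the one of `Λ` and `J`. -/
lemma dualConcomitant_comp (hΛ : IsBivector I Λ) (hJ : IsNijenhuis I J) {α : Form I M}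
    (hα : SmoothForm I α) {X : Vec I M} (hX : SmoothVec I X) (x : M) :
    dualConcomitant (comp I J Λ) J α X x = J x (dualConcomitant Λ J α X x) := by
  -- Only the two bracket terms need an argument: zero torsion for `Λα` and `X` says that replacing
  -- `Λα` by `JΛα` in them amounts to applying `J`. In the other two terms the factor `J` is already
  -- outside.
  have h := hJ.mlieBracket_app (hΛ.smoothVec_sharp hα) hX x
  simp only [dualConcomitant, map_sub, map_add]
  change mlieBracket I (app I J (sharp I Λ α)) (app I J X) x
    - J x (mlieBracket I (app I J (sharp I Λ α)) X x) - J x (Λ x (lieForm I X (transp I J α) x))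
    + J x (Λ x (lieForm I (app I J X) α x)) = _
  rw [h]
  abel

lemma Commutes.comp_skew (hc : Commutes I J Λ) (hΛ : IsBivector I Λ) (x : M)
    (a b : TangentSpace I x →L[ℝ] ℝ) : b (J x (Λ x a)) = - a (J x (Λ x b)) := by
  rw [hc x b]
  exact hΛ.skew x a (b.comp (J x))

/-- The compatibility of the concomitant of `Λ` and `J` with the vector field `V`. -/
def ConcomitantRel (Λ : Biv I M) (V : Vec I M) (J : Endo I M) : Prop :=
  ∀ (f : M → ℝ) (γ : Form I M), SmoothFun I f → SmoothForm I γ → ∀ x,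
    dualConcomitant Λ J (mvfderiv I f) (sharp I (comp I J Λ) γ) x =
      γ x (J x (J x (V x))) • ham Λ f x - γ x (J x (V x)) • J x (ham Λ f x)

/-- Apply the relation to `ᵗJγ`, for which `JΛ(ᵗJγ) = J(JΛ)γ`, and then apply `J` to both sides. -/
lemma ConcomitantRel.comp_endo (hD : ConcomitantRel Λ V J) (hΛ : IsBivector I Λ)
    (hJ : IsNijenhuis I J) (hc : Commutes I J Λ) :
    ConcomitantRel (comp I J Λ) (app I J V) J := by
  intro f γ hf hγ x
  have h := hD f (transp I J γ) hf (hJ.smooth.smoothForm_transp hγ) x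
  rw [← hc.comp_endo.comp_sharp] at h
  have hX : SmoothVec I (sharp I (comp I J (comp I J Λ)) γ) :=
    hJ.smooth.smoothVec_app (hJ.smooth.smoothVec_app (hΛ.smoothVec_sharp hγ))
  rw [dualConcomitant_comp hΛ hJ hf.smoothForm hX, h, map_sub, map_smul, map_smul]
  rfl

/-- Zero torsion splits `[JΛdf, JΛdg]` into brackets of the form `[Λdf, Λ(ᵗJdg)]` and `[Λdf, Λdg]`,
all known from the relation for `(Λ, V)`. Paired with `dh`, what is left over is the pairing of `dg`
with the concomitant relation for `df` and the field `JΛdh`. -/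
lemma SchoutenRel.comp_endo (hS : SchoutenRel Λ V) (hΛ : IsBivector I Λ) (hJ : IsNijenhuis I J)
    (hc : Commutes I J Λ) (hD : ConcomitantRel Λ V J) :
    SchoutenRel (comp I J Λ) (app I J V) := by
  intro f g hf hg x
  refine tangent_ext fun h hh => ?_
  have hXf := hΛ.smoothVec_ham hf
  have hXg := hΛ.smoothVec_ham hg
  have hYh : SmoothVec I (ham (comp I J Λ) h) :=
    hJ.smooth.smoothVec_app (hΛ.smoothVec_ham hh)
  have hJYh := hJ.smooth.smoothVec_app hYh
  have hαf := hJ.smooth.smoothForm_transp hf.smoothForm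
  have hαg := hJ.smooth.smoothForm_transp hg.smoothForm
  have efun : ∀ u : M → ℝ, ham (comp I J Λ) u = sharp I Λ (transp I J (mvfderiv I u)) :=
    fun u => hc.comp_sharp _
  have esk : ∀ a : TangentSpace I x →L[ℝ] ℝ, mvfderiv I h x (J x (Λ x a)) =
      - a (ham (comp I J Λ) h x) := fun a => hc.comp_skew hΛ x a _
  have l1 := hJ.mlieBracket_app hXf hXg x
  have l2 := hS.mlieBracket_sharp hΛ hαg hf x
  have l3 := hS.mlieBracket_sharp hΛ hαf hg x
  rw [← efun] at l2 l3
  have l4 := hS f g hf hg x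
  have l5 := mlieBracket_swap_apply (I := I) (V := ham (comp I J Λ) f)
    (W := ham Λ g) (x := x)
  have d1 := lieForm_apply I (X := ham Λ f) hαg hYh x
  have d2 := lieForm_apply I (X := ham Λ g) hαf hYh x
  have d3 := lieForm_apply I (X := ham (comp I J Λ) h) hαf hXg x
  have d4 := sharp_lieForm_mvfderiv hΛ hJYh hf x
  have d5 := dir_mlieBracket hg hXf hJYh x
  -- The choice `γ = dh` makes the test field `JΛdh`, the same field that appears when `J ∘ Λ` is
  -- moved onto `dh` by skewness.
  have d6 := congrArg (mvfderiv I g x) (hD f (mvfderiv I h) hf hh.smoothForm x)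
  have d7 := mlieBracket_swap_apply (I := I) (V := ham (comp I J Λ) h)
    (W := ham Λ g) (x := x)
  have q1 : (fun y => transp I J (mvfderiv I f) y (ham Λ g y)) =
      fun y => - pb (comp I J Λ) f g y :=
    funext fun y => hc.comp_skew hΛ y _ _
  have q2 : transp I J (mvfderiv I f) x (ham Λ g x) =
      - pb (comp I J Λ) f g x := hc.comp_skew hΛ x _ _
  rw [q1, mvfderiv_fun_neg, d7] at d3
  have p1 : mvfderiv I g x (Λ x (lieForm I (ham (comp I J Λ) h)
      (transp I J (mvfderiv I f)) x)) = _ := (hΛ.skew x _ _).trans (congrArg Neg.neg d3)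
  have p2 : mvfderiv I g x (ham Λ (dir (app I J (ham (comp I J Λ) h)) f) x) =
      - mvfderiv I (dir (app I J (ham (comp I J Λ) h)) f) x (ham Λ g x) :=
    hΛ.skew x _ _
  change mvfderiv I g x (mlieBracket I (ham Λ f) (app I J (ham (comp I J Λ) h)) x
    - J x (mlieBracket I (ham Λ f) (ham (comp I J Λ) h) x)
    - Λ x (lieForm I (ham (comp I J Λ) h) (transp I J (mvfderiv I f)) x)
    + Λ x (lieForm I (app I J (ham (comp I J Λ) h)) (mvfderiv I f) x)) = _ at d6
  rw [d4] at d6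
  simp only [map_sub, map_add, map_smul, smul_eq_mul] at d6
  rw [d5, p1, p2] at d6
  have r1 : mvfderiv I h x (J x (ham (comp I J Λ) (pb Λ f g) x)) = - mvfderiv I (pb Λ f g) x
      (app I J (ham (comp I J Λ) h) x) := by
    have e1 := hc x (mvfderiv I (pb Λ f g) x)
    change mvfderiv I h x (J x (J x (Λ x _))) = _
    rw [e1]
    exact hc.comp_skew hΛ x ((mvfderiv I (pb Λ f g) x).comp (J x)) _
  have r2 : mvfderiv I h x (ham (comp I J Λ) (pb (comp I J Λ) f g) x) =
      - mvfderiv I (pb (comp I J Λ) f g) x (ham (comp I J Λ) h x) :=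
    hc.comp_skew hΛ x _ _
  have r3 : ∀ u : M → ℝ, app I J (ham Λ u) = ham (comp I J Λ) u := fun _ => rfl
  have r4 : ∀ u : M → ℝ, J x (ham Λ u x) = ham (comp I J Λ) u x := fun _ => rfl
  have r5 : ∀ u : M → ℝ, dir (app I J V) u x = mvfderiv I u x (J x (V x)) := fun _ => rfl
  rw [r3, r3, l5, l2, l3, l4] at l1
  rw [l1]
  simp only [map_sub, map_add, map_neg, map_smul, smul_eq_mul, esk, d1, d2, r1, r2, r5, q2, r4]
  have k1 : ∀ u : M → ℝ, (fun y => transp I J (mvfderiv I u) y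
      (ham (comp I J Λ) h y)) =
      dir (app I J (ham (comp I J Λ) h)) u := fun _ => rfl
  have k2 : ∀ (u : M → ℝ) (v : TangentSpace I x),
    transp I J (mvfderiv I u) x v = mvfderiv I u x (J x v) := fun _ _ => rfl
  have k3 : ∀ u v : M → ℝ, dir (ham Λ u) v = pb Λ u v := fun _ _ => rfl
  have k4 : ∀ W : Vec I M, app I J W x = J x (W x) := fun _ => rfl
  have k5 : ∀ u v : M → ℝ, mvfderiv I v x (ham Λ u x) = pb Λ u v x := fun _ _ => rfl
  have k6 : ∀ u v : M → ℝ, mvfderiv I v x (ham (comp I J Λ) u x) =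
    pb (comp I J Λ) u v x := fun _ _ => rfl
  simp only [neg_apply, map_neg, k1, k2, k3, k4, r4, k5, k6] at d6 ⊢
  linear_combination -d6

/-! ### The hierarchy of Jacobi structures -/

/-- In condition (ii) the factor `γ ∘ J ∘ Λ` acts on the concomitant. Skewness of `J ∘ Λ` turns this
into minus the concomitant evaluated on `JΛγ`, and `concomitant_apply` dualizes it. -/
lemma IsCompatible.concomitantRel (hC : IsCompatible I Λ V J) (hΛ : IsBivector I Λ)
    (hJ : SmoothEndo I J) : ConcomitantRel Λ V J := by
  intro f γ hf hγ x
  refine tangent_ext fun g hg => ?_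
  have hX : SmoothVec I (sharp I (comp I J Λ) γ) :=
    hJ.smoothVec_app (hΛ.smoothVec_sharp hγ)
  have h1 := concomitant_apply hΛ hJ hC.commutes hf.smoothForm hg hX x
  have h2 := hC.concomitant_eq _ _ γ hf.smoothForm hg.smoothForm hγ x
  have h3 := hC.commutes.comp_skew hΛ x
    (concomitant I Λ J (mvfderiv I f) (mvfderiv I g) x) (γ x)
  change γ x (J x (_ - mvfderiv I g x (ham Λ f x) • _ +
    mvfderiv I g x (J x (ham Λ f x)) • _)) = 0 at h2
  change _ = - concomitant I Λ J (mvfderiv I f) (mvfderiv I g) x (sharp I (comp I J Λ) γ x) at h3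
  simp only [map_sub, map_add, map_smul, smul_eq_mul, h3, h1] at h2 ⊢
  linear_combination h2

lemma IsBivector.comp_power (hΛ : IsBivector I Λ) (hJ : SmoothEndo I J) (hc : Commutes I J Λ)
    (k : ℕ) : IsBivector I (comp I (power I J k) Λ) ∧ Commutes I J (comp I (power I J k) Λ) := by
  induction k with
  | zero => rw [comp_power_zero]; exact ⟨hΛ, hc⟩
  | succ k ih => rw [comp_power_succ]; exact ⟨ih.1.comp_endo hJ ih.2, ih.2.comp_endo⟩

lemma ConcomitantRel.schoutenRel_power (hD : ConcomitantRel Λ V J) (hS : SchoutenRel Λ V)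
    (hΛ : IsBivector I Λ) (hJ : IsNijenhuis I J) (hc : Commutes I J Λ) (k : ℕ) :
    ConcomitantRel (comp I (power I J k) Λ) (app I (power I J k) V) J ∧
      SchoutenRel (comp I (power I J k) Λ) (app I (power I J k) V) := by
  induction k with
  | zero => rw [comp_power_zero, app_power_zero]; exact ⟨hD, hS⟩
  | succ k ih =>
    obtain ⟨hΛ', hc'⟩ := hΛ.comp_power hJ.smooth hc k
    rw [comp_power_succ, app_power_succ]
    exact ⟨ih.1.comp_endo hΛ' hJ hc', ih.2.comp_endo hΛ' hJ hc' ih.1⟩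

/-- Zero torsion for `J^k` reduces `[J^k V, J^k Λdf]` to `J^k` applied to `[J^k V, Λdf] + [V, J^k
Λdf] - J^k [V, Λdf]`. The last bracket is known from `hi`, and condition (iii) evaluates the sum of
the other two. Since (iii) starts at `k = 1`, the case `k = 0` is the hypothesis itself. -/
lemma IsCompatible.invariantRel_power (hC : IsCompatible I Λ V J) (hV : SmoothVec I V)
    (hi : InvariantRel Λ V)
    (hΛ : IsBivector I Λ) (hJ : IsNijenhuis I J) (k : ℕ) :
    InvariantRel (comp I (power I J k) Λ) (app I (power I J k) V) := by
  rcases Nat.eq_zero_or_pos k with rfl | hk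
  · rwa [comp_power_zero, app_power_zero]
  intro f hf x
  have hΛk := (hΛ.comp_power hJ.smooth hC.commutes k).1
  have hVk := hJ.smooth.smoothVec_app_power hV k
  have h1 := hJ.mlieBracket_app_power hV (hΛ.smoothVec_ham hf) k k x
  have h2 : mlieBracket I (app I (power I J k) V) (ham Λ f) x
      - ham Λ (dir (app I (power I J k) V) f) x
      + (mlieBracket I V (ham (comp I (power I J k) Λ) f) x
        - ham (comp I (power I J k) Λ) (dir V f) x) = 0 := by
    refine tangent_ext fun g hg => ?_
    have h := hC.lie_eq k hk _ _ hf.smoothForm hg.smoothForm x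
    rw [lieBiv_eq hΛ _ hf.smoothForm hg.smoothForm, lieBiv_eq hΛk _ hf.smoothForm hg.smoothForm,
      lieSharp_mvfderiv hΛ hVk hf, lieSharp_mvfderiv hΛk hV hf, ← map_add] at h
    rw [h, map_zero]
  rw [hi f hf, power_add_apply] at h1
  change mlieBracket I (app I (power I J k) V) (app I (power I J k) (ham Λ f)) x =
    power I J k x (ham Λ (dir (app I (power I J k) V) f) x)
  change _ + (mlieBracket I V (app I (power I J k) (ham Λ f)) x
    - power I J k x (ham Λ (dir V f) x)) = 0 at h2
  have h3 := congrArg (power I J k x) h2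
  simp only [map_add, map_sub, map_zero] at h3
  rw [h1, ← sub_eq_zero, ← h3]
  abel

/-- The hierarchy of Jacobi structures defined by a compatible Nijenhuis tensor. -/
theorem IsCompatible.isJacobi_power (hC : IsCompatible I Λ V J) (hΛV : IsJacobi I Λ V)
    (hJ : IsNijenhuis I J) (k : ℕ) :
    IsJacobi I (comp I (power I J k) Λ) (app I (power I J k) V) := by
  obtain ⟨hΛ, hV, hS, hi⟩ := isJacobi_iff_rel.1 hΛV
  exact isJacobi_iff_rel.2 ⟨(hΛ.comp_power hJ.smooth hC.commutes k).1,
    hJ.smooth.smoothVec_app_power hV k,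
    ((hC.concomitantRel hΛ hJ.smooth).schoutenRel_power hS hΛ hJ hC.commutes k).2,
    hC.invariantRel_power hV hi hΛ hJ k⟩

end Hierarchy

/-! ### Tensoriality of the Jacobiator, and the identity as a Nijenhuis tensor -/

section Poisson

variable {E : Type*} [NormedAddCommGroup E] [NormedSpace ℝ E] [FiniteDimensional ℝ E]
  {H : Type*} [TopologicalSpace H] {I : ModelWithCorners ℝ E H} [I.Boundaryless]
  {M : Type*} [TopologicalSpace M] [ChartedSpace H M] [IsManifold I ∞ M] [T2Space M]
  {Λ : Biv I M} {V : Vec I M} {J : Endo I M}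

/-! ### Poisson structures -/

lemma smoothVec_zero : SmoothVec I (fun _ : M => 0) :=
  smoothVec_of_smoothFun fun f _ => by simpa using smoothFun_const 0

lemma schoutenTerm_eq (hΛ : IsBivector I Λ) {f g h : M → ℝ} (hf : SmoothFun I f)
    (hg : SmoothFun I g) (hh : SmoothFun I h) (x : M) :
    schoutenTerm Λ (fun _ => 0) f g h x =
      mvfderiv I h x (mlieBracket I (ham Λ f) (ham Λ g) x - ham Λ (pb Λ f g) x) := by
  rw [map_sub, dir_mlieBracket_ham hΛ hf hg hh]
  have s1 := congrFun (hΛ.pb_swap h (pb Λ f g)) x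
  change _ = _ - pb Λ (pb Λ f g) h x
  simp only [schoutenTerm, dir, map_zero]
  rw [s1]
  ring

lemma schoutenTerm_cycle (f g h : M → ℝ) (x : M) :
    schoutenTerm Λ V f g h x = schoutenTerm Λ V g h f x := by
  simp only [schoutenTerm]
  ring

/-- The Jacobiator of a bivector field at a point only depends on the differentials there. -/
lemma schoutenTerm_congr (hΛ : IsBivector I Λ) {f g h f' g' h' : M → ℝ}
    (hf : SmoothFun I f) (hg : SmoothFun I g) (hh : SmoothFun I h)
    (hf' : SmoothFun I f') (hg' : SmoothFun I g') (hh' : SmoothFun I h') {x : M}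
    (ef : mvfderiv I f x = mvfderiv I f' x) (eg : mvfderiv I g x = mvfderiv I g' x)
    (eh : mvfderiv I h x = mvfderiv I h' x) :
    schoutenTerm Λ (fun _ => 0) f g h x = schoutenTerm Λ (fun _ => 0) f' g' h' x := by
  -- By `schoutenTerm_eq` the third function enters only through its differential at `x`. Rotating
  -- cyclically brings each function into that place in turn.
  rw [schoutenTerm_eq hΛ hf hg hh, eh, ← schoutenTerm_eq hΛ hf hg hh', schoutenTerm_cycle,
    schoutenTerm_eq hΛ hg hh' hf, ef, ← schoutenTerm_eq hΛ hg hh' hf', schoutenTerm_cycle,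
    schoutenTerm_eq hΛ hh' hf' hg, eg, ← schoutenTerm_eq hΛ hh' hf' hg', schoutenTerm_cycle]

lemma isPoisson_iff : IsPoisson I Λ ↔ IsBivector I Λ ∧
    ∀ f g h : M → ℝ, SmoothFun I f → SmoothFun I g → SmoothFun I h → ∀ x,
      schoutenTerm Λ (fun _ => 0) f g h x = 0 := by
  rw [IsPoisson, isJacobi_iff]
  refine ⟨fun h => ⟨h.1, h.2.2.1⟩, fun h => ⟨h.1, smoothVec_zero, h.2, fun f g _ _ x => ?_⟩⟩
  have z : ∀ u : M → ℝ, dir (fun x : M => (0 : TangentSpace I x)) u = fun _ => 0 := fun u => by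
    ext y; simp [dir]
  simp [invTerm, z, pb, ham, sharp, mvfderiv_fun_const]

/-! ### The identity as a Nijenhuis tensor -/

lemma smoothEndo_id : SmoothEndo I (fun x : M => ContinuousLinearMap.id ℝ (TangentSpace I x)) := by
  intro x
  rw [contMDiffAt_hom_bundle]
  refine ⟨contMDiffAt_id,
    (contMDiffAt_const (c := ContinuousLinearMap.id ℝ E)).congr_of_eventuallyEq ?_⟩
  filter_upwards [chart_source_mem_nhds H x] with y hy
  have hy' : y ∈ (trivializationAt E (TangentSpace I) x).baseSet := by simpa using hy
  ext v
  exact Trivialization.continuousLinearMapAt_symmL (R := ℝ) _ hy' v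

lemma isNijenhuis_id :
    IsNijenhuis I (fun x : M => ContinuousLinearMap.id ℝ (TangentSpace I x)) where
  smooth := smoothEndo_id
  torsion_eq_zero X Y _ _ x := by
    change mlieBracket I X Y x - mlieBracket I X Y x - mlieBracket I X Y x
      + mlieBracket I X Y x = 0
    abel

/-- A Poisson structure and the identity form a Poisson–Nijenhuis structure. For the Poissonization
of a general Jacobi structure `(Λ, V)` this is the tensor to take: if `Λ = 0` and `V ≠ 0`, every
tensor that commutes with `e⁻ᵗ ∂ₜ ∧ V` is a multiple of the identity on the span of `∂ₜ` and `V`. -/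
lemma IsPoisson.isPoissonNijenhuis_id (hP : IsPoisson I Λ) :
    IsPoissonNijenhuis I Λ (fun x : M => ContinuousLinearMap.id ℝ (TangentSpace I x)) where
  isPoisson := hP
  isNijenhuis := isNijenhuis_id
  commutes _ _ := rfl
  concomitant_eq_zero α β _ _ x := by
    change formBracket I Λ α β x - (formBracket I Λ α β x + formBracket I Λ α β x
      - formBracket I Λ α β x) = 0
    abel

end Poisson

/-! ### Poissonization of a Jacobi structure on `M × ℝ` -/

section Poissonization

variable {E : Type*} [NormedAddCommGroup E] [NormedSpace ℝ E] [FiniteDimensional ℝ E]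
  {H : Type*} [TopologicalSpace H] {I : ModelWithCorners ℝ E H} [I.Boundaryless]
  {M : Type*} [TopologicalSpace M] [ChartedSpace H M] [IsManifold I ∞ M] [T2Space M]
  {Λ : Biv I M} {V : Vec I M}

/-! ### Poissonization -/

/-- The linear map `e⁻ᵗ (Λ + ∂ₜ ∧ V)` for `L = Λ`, `v = V` and `c = e⁻ᵗ`. -/
noncomputable def poissonMap (L : (E →L[ℝ] ℝ) →L[ℝ] E) (v : E) (c : ℝ) :
    ((E × ℝ) →L[ℝ] ℝ) →L[ℝ] E × ℝ :=
  c • ((L.comp ((ContinuousLinearMap.compL ℝ E (E × ℝ) ℝ).flip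
      (ContinuousLinearMap.inl ℝ E ℝ))
    + (ContinuousLinearMap.apply ℝ ℝ ((0, 1) : E × ℝ)).smulRight v).prod
      (-(ContinuousLinearMap.apply ℝ ℝ ((v, 0) : E × ℝ))))

lemma poissonMap_apply (L : (E →L[ℝ] ℝ) →L[ℝ] E) (v : E) (c : ℝ) (a : (E × ℝ) →L[ℝ] ℝ) :
    poissonMap L v c a = (c • (L (a.comp (ContinuousLinearMap.inl ℝ E ℝ)) + a (0, 1) • v),
      c * - a (v, 0)) := rfl

/-- The Poissonization `e⁻ᵗ (Λ + ∂ₜ ∧ V)` of a Jacobi structure `(Λ, V)`. -/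
noncomputable def poissonization (Λ : Biv I M) (V : Vec I M) : Biv (I.prod 𝓘(ℝ, ℝ)) (M × ℝ) :=
  fun p => poissonMap (E := E) (Λ p.1) (V p.1) (Real.exp (-p.2))

lemma smoothFun_fst {f : M → ℝ} (hf : SmoothFun I f) :
    SmoothFun (I.prod 𝓘(ℝ, ℝ)) (fun p : M × ℝ => f p.1) :=
  ContMDiff.comp hf contMDiff_fst

lemma smoothFun_snd {φ : ℝ → ℝ} (hφ : ContDiff ℝ ∞ φ) :
    SmoothFun (I.prod 𝓘(ℝ, ℝ)) (fun p : M × ℝ => φ p.2) :=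
  ContMDiff.comp hφ.contMDiff contMDiff_snd

lemma mvfderiv_fst {f : M → ℝ} (hf : SmoothFun I f) (p : M × ℝ) :
    mvfderiv (I.prod 𝓘(ℝ, ℝ)) (fun p : M × ℝ => f p.1) p =
      (mvfderiv I f p.1).comp (ContinuousLinearMap.fst ℝ E ℝ) := by
  have h := mfderiv_comp p (hf.mdifferentiableAt p.1) (mdifferentiableAt_fst (I := I)
    (I' := 𝓘(ℝ, ℝ)) (x := p))
  rw [mfderiv_fst] at h
  ext v
  exact congrArg (fun L : E × ℝ →L[ℝ] ℝ => L v) h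

lemma mvfderiv_snd {φ : ℝ → ℝ} (hφ : ContDiff ℝ ∞ φ) (p : M × ℝ) :
    mvfderiv (I.prod 𝓘(ℝ, ℝ)) (fun p : M × ℝ => φ p.2) p =
      (deriv φ p.2) • (ContinuousLinearMap.snd ℝ E ℝ) := by
  have h0 := hφ.differentiable (by simp) p.2
  have h := mfderiv_comp p h0.mdifferentiableAt (mdifferentiableAt_snd (I := I)
    (I' := 𝓘(ℝ, ℝ)) (x := p))
  rw [mfderiv_snd, mfderiv_eq_fderiv] at h
  ext v
  refine (congrArg (fun L : E × ℝ →L[ℝ] ℝ => L v) h).trans ?_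
  change fderiv ℝ φ p.2 v.2 = deriv φ p.2 * v.2
  rw [fderiv_eq_smul_deriv, smul_eq_mul, mul_comm]

lemma poissonMap_pair (L : (E →L[ℝ] ℝ) →L[ℝ] E) (v : E) (c : ℝ) {a b : E × ℝ →L[ℝ] ℝ}
    {α β : E →L[ℝ] ℝ} {r s : ℝ} (ha : ∀ u t, a (u, t) = α u + r * t)
    (hb : ∀ u t, b (u, t) = β u + s * t) :
    b (poissonMap L v c a) = c * (β (L α) + r * β v - s * α v) := by
  have e : a.comp (ContinuousLinearMap.inl ℝ E ℝ) = α := by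
    ext u
    exact (ha u 0).trans (by ring)
  rw [poissonMap_apply, e, hb, ha, ha]
  simp only [map_smul, map_add, smul_eq_mul, map_zero]
  ring

lemma clm_prod_apply (a : E × ℝ →L[ℝ] ℝ) (u : E) (t : ℝ) :
    a (u, t) = a.comp (ContinuousLinearMap.inl ℝ E ℝ) u + a (0, 1) * t := by
  change _ = a (u, 0) + _
  rw [mul_comm, ← smul_eq_mul, ← map_smul, ← map_add]
  simp

lemma poissonMap_skew {L : (E →L[ℝ] ℝ) →L[ℝ] E} (hL : ∀ a b : E →L[ℝ] ℝ, b (L a) = - a (L b))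
    (v : E) (c : ℝ) (a b : E × ℝ →L[ℝ] ℝ) :
    b (poissonMap L v c a) = - a (poissonMap L v c b) := by
  rw [poissonMap_pair L v c (clm_prod_apply a) (clm_prod_apply b),
    poissonMap_pair L v c (clm_prod_apply b) (clm_prod_apply a), hL]
  ring

/-- Near a point, the differential of a product-chart coordinate is `df + c dt` with `f` a function
on `M` and `c` constant. On such covectors the bivector is an explicit smooth expression in `Λ(df,
dg)`, `Vf` and `Vg`. -/
lemma isBivector_poissonization (hΛ : IsBivector I Λ) (hV : SmoothVec I V) :
    IsBivector (I.prod 𝓘(ℝ, ℝ)) (poissonization Λ V) := by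
  refine isBivector_of_coord (fun p a b => ?_) fun p α β => ?_
  · exact poissonMap_skew (E := E) (hΛ.skew p.1) (V p.1) _ a b
  · have key : ∀ α : E × ℝ →L[ℝ] ℝ, ∃ (f : M → ℝ) (c : ℝ), SmoothFun I f ∧ ∀ᶠ q in 𝓝 p,
        ∀ (u : E) (t : ℝ), mvfderiv (I.prod 𝓘(ℝ, ℝ)) (α ∘ extChartAt (I.prod 𝓘(ℝ, ℝ)) p) q (u, t) =
          mvfderiv I f q.1 u + c * t := by
      intro α
      obtain ⟨f, hf, hfα⟩ := exists_smoothFun_eventuallyEq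
        (eventually_contMDiffAt_comp_extChartAt (I := I)
          (α.comp (ContinuousLinearMap.inl ℝ E ℝ)) p.1)
      refine ⟨f, α (0, 1), hf, ?_⟩
      have hφ : ContDiff ℝ ∞ (fun t : ℝ => α (0, 1) * t) := contDiff_const.mul contDiff_id
      have h1 : α ∘ extChartAt (I.prod 𝓘(ℝ, ℝ)) p =ᶠ[𝓝 p]
          fun q => f q.1 + α (0, 1) * q.2 := by
        filter_upwards [continuousAt_fst.eventually hfα] with q hq
        rw [hq]
        have h3 : extChartAt (I.prod 𝓘(ℝ, ℝ)) p q = (extChartAt I p.1 q.1, q.2) := by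
          rw [extChartAt_prod]
          rfl
        simp only [Function.comp_apply]
        rw [h3, clm_prod_apply]
      filter_upwards [h1.eventuallyEq_nhds] with q hq u t
      rw [mvfderiv_congr hq, mvfderiv_fun_add (smoothFun_fst hf) (smoothFun_snd hφ),
        mvfderiv_fst hf, mvfderiv_snd hφ]
      have hd : deriv (fun t : ℝ => α (0, 1) * t) q.2 = α (0, 1) := by simp
      rw [hd]
      rfl
    obtain ⟨f, c, hf, hfc⟩ := key α
    obtain ⟨g, d, hg, hgd⟩ := key β
    have hs : SmoothFun (I.prod 𝓘(ℝ, ℝ)) (fun q : M × ℝ => Real.exp (- q.2) *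
        (pb Λ f g q.1 + c * dir V g q.1 - d * dir V f q.1)) := by
      refine (smoothFun_snd (φ := fun t => Real.exp (- t)) (by fun_prop)).mul ?_
      exact smoothFun_fst (((hΛ.smoothFun_pb hf hg).add ((smoothFun_const c).mul (hg.dir hV))).sub
        ((smoothFun_const d).mul (hf.dir hV)))
    refine (hs p).congr_of_eventuallyEq ?_
    filter_upwards [hfc, hgd] with q h1 h2
    exact poissonMap_pair (E := E) (Λ q.1) (V q.1) (Real.exp (-q.2)) h1 h2

lemma smoothFun_exp_mul {f : M → ℝ} (hf : SmoothFun I f) :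
    SmoothFun (I.prod 𝓘(ℝ, ℝ)) (fun p : M × ℝ => Real.exp p.2 * f p.1) :=
  (smoothFun_snd Real.contDiff_exp).mul (smoothFun_fst hf)

lemma mvfderiv_exp_mul {f : M → ℝ} (hf : SmoothFun I f) (p : M × ℝ) (u : E) (t : ℝ) :
    mvfderiv (I.prod 𝓘(ℝ, ℝ)) (fun p : M × ℝ => Real.exp p.2 * f p.1) p (u, t) =
      (Real.exp p.2 • (mvfderiv I f p.1 : E →L[ℝ] ℝ)) u + (Real.exp p.2 * f p.1) * t := by
  rw [mvfderiv_fun_mul (smoothFun_snd Real.contDiff_exp) (smoothFun_fst hf),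
    mvfderiv_fst hf, mvfderiv_snd Real.contDiff_exp, Real.deriv_exp]
  change Real.exp p.2 * (mvfderiv I f p.1 u) + f p.1 * (Real.exp p.2 * t) =
    Real.exp p.2 * (mvfderiv I f p.1 u) + (Real.exp p.2 * f p.1) * t
  ring

/-- The bracket of the Poissonization on homogeneous functions. -/
lemma pb_poissonization {f g : M → ℝ} (hf : SmoothFun I f) (hg : SmoothFun I g) :
    pb (poissonization Λ V) (fun p : M × ℝ => Real.exp p.2 * f p.1)
      (fun p : M × ℝ => Real.exp p.2 * g p.1) = fun p => Real.exp p.2 * bracket I Λ V f g p.1 := by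
  ext p
  have h := poissonMap_pair (E := E) (Λ p.1) (V p.1) (Real.exp (-p.2))
    (mvfderiv_exp_mul hf p) (mvfderiv_exp_mul hg p)
  refine h.trans ?_
  have h2 : Real.exp (-p.2) * Real.exp p.2 = 1 := by rw [← Real.exp_add]; simp
  set e := Real.exp p.2
  set e' := Real.exp (-p.2)
  have h3 : (e • (mvfderiv I g p.1 : E →L[ℝ] ℝ))
      ((Λ p.1 : (E →L[ℝ] ℝ) →L[ℝ] E) (e • (mvfderiv I f p.1 : E →L[ℝ] ℝ))) =
      e * (e * pb Λ f g p.1) := by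
    rw [map_smul, map_smul]
    rfl
  refine (congrArg (fun z => e' * (z + _ - _)) h3).trans ?_
  change e' * (_ + e * f p.1 * (e * dir V g p.1) - e * g p.1 * (e * dir V f p.1)) =
    e * (pb Λ f g p.1 + (f p.1 * dir V g p.1 - g p.1 * dir V f p.1))
  linear_combination (e * (pb Λ f g p.1 + (f p.1 * dir V g p.1 - g p.1 * dir V f p.1))) * h2

-- The Jacobiator depends only on differentials at the point, so each function may be replaced by
-- one of the form `eᵗ f`. These are closed under the bracket, by `pb_poissonization`, and the
-- identity becomes the one for `(Λ, V)`.
theorem IsJacobi.isPoisson_poissonization (h : IsJacobi I Λ V) :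
    IsPoisson (I.prod 𝓘(ℝ, ℝ)) (poissonization Λ V) := by
  have hP := isBivector_poissonization h.isBivector h.smoothVec
  have hb : ∀ f g : M → ℝ, SmoothFun I f → SmoothFun I g → SmoothFun I (bracket I Λ V f g) :=
    fun f g hf hg => (h.isBivector.smoothFun_pb hf hg).add
      ((hf.mul (hg.dir h.smoothVec)).sub (hg.mul (hf.dir h.smoothVec)))
  refine isPoisson_iff.2 ⟨hP, fun F G K hF hG hK p => ?_⟩
  have key : ∀ F : M × ℝ → ℝ, ∃ f : M → ℝ, SmoothFun I f ∧
      mvfderiv (I.prod 𝓘(ℝ, ℝ)) F p =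
        mvfderiv (I.prod 𝓘(ℝ, ℝ)) (fun p : M × ℝ => Real.exp p.2 * f p.1) p := by
    intro F
    let A : E × ℝ →L[ℝ] ℝ := mvfderiv (I.prod 𝓘(ℝ, ℝ)) F p
    obtain ⟨f, hf, hfA⟩ := exists_smoothFun_mvfderiv_eq (I := I) p.1
      (Real.exp (- p.2) • A.comp (ContinuousLinearMap.inl ℝ E ℝ))
    -- Since `d(eᵗ f) = eᵗ df + eᵗ f dt`, the horizontal part of `A` fixes `df` and its `dt` part
    -- fixes the value of `f`; the added constant adjusts that value without changing `df`.
    have hf' := hf.add (smoothFun_const (I := I) (Real.exp (- p.2) * A (0, 1) - f p.1))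
    refine ⟨_, hf', ?_⟩
    have h : Real.exp p.2 * Real.exp (-p.2) = 1 := by rw [← Real.exp_add]; simp
    ext ⟨u, t⟩
    refine (clm_prod_apply A u t).trans (.trans ?_ (mvfderiv_exp_mul hf' p u t).symm)
    rw [mvfderiv_fun_add hf (smoothFun_const _), mvfderiv_fun_const, add_zero, hfA]
    change A (u, 0) + _ = Real.exp p.2 * (Real.exp (- p.2) * A (u, 0)) + _
    linear_combination - (A (u, 0) + t * A (0, 1)) * h
  obtain ⟨f, hf, ef⟩ := key F
  obtain ⟨g, hg, eg⟩ := key G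
  obtain ⟨k, hk, ek⟩ := key K
  rw [schoutenTerm_congr hP hF hG hK (smoothFun_exp_mul hf) (smoothFun_exp_mul hg)
    (smoothFun_exp_mul hk) ef eg ek]
  simp only [schoutenTerm, dir, map_zero, zero_mul, add_zero]
  rw [pb_poissonization hg hk, pb_poissonization hk hf, pb_poissonization hf hg,
    pb_poissonization hf (hb g k hg hk), pb_poissonization hg (hb k f hk hf),
    pb_poissonization hk (hb f g hf hg), ← mul_add, ← mul_add, h.jacobi f g k hf hg hk, mul_zero]

/-- The projection of the Poissonization is a conformal Jacobi morphism. -/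
theorem IsJacobi.isConformalJacobiMorphism_fst (h : IsJacobi I Λ V) :
    IsConformalJacobiMorphism (I.prod 𝓘(ℝ, ℝ)) I (poissonization Λ V) (fun _ => 0) Λ V
      (Prod.fst : M × ℝ → M) where
  source := h.isPoisson_poissonization
  target := h
  smooth := contMDiff_fst
  conformal := by
    refine ⟨fun p => Real.exp p.2, smoothFun_snd Real.contDiff_exp, fun p => Real.exp_ne_zero _,
      fun f g hf hg p => ?_⟩
    simp only [bracket_eq, dir, map_zero, mul_zero, sub_zero, add_zero]
    rw [pb_poissonization hf hg]
    rfl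

end Poissonization

/-! ### Poisson–Nijenhuis hierarchies: Poisson property, pencils, homogeneity -/

section PoissonNijenhuis

variable {E : Type*} [NormedAddCommGroup E] [NormedSpace ℝ E] [FiniteDimensional ℝ E]
  {H : Type*} [TopologicalSpace H] {I : ModelWithCorners ℝ E H} [I.Boundaryless]
  {M : Type*} [TopologicalSpace M] [ChartedSpace H M] [IsManifold I ∞ M] [T2Space M]
  {P Q : Biv I M} {Z : Vec I M} {J : Endo I M}

/-! ### The hierarchy of Poisson structures -/

/-- The concomitant of `P` and `J` vanishes, on smooth arguments. -/
def ConcomitantZero (P : Biv I M) (J : Endo I M) : Prop :=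
  ∀ (α : Form I M) (X : Vec I M), SmoothForm I α → SmoothVec I X → ∀ x,
    dualConcomitant P J α X x = 0

lemma IsPoissonNijenhuis.concomitantZero (h : IsPoissonNijenhuis I P J) :
    ConcomitantZero P J := by
  intro α X hα hX x
  refine tangent_ext fun g hg => ?_
  have h1 := concomitant_apply h.isPoisson.isBivector h.isNijenhuis.smooth h.commutes hα hg hX x
  rw [h.concomitant_eq_zero α _ hα hg.smoothForm, _root_.zero_apply, eq_comm, neg_eq_zero] at h1
  rw [h1, map_zero]

lemma ConcomitantZero.comp_power (h : ConcomitantZero P J) (hP : IsBivector I P)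
    (hJ : IsNijenhuis I J) (hc : Commutes I J P) (k : ℕ) :
    ConcomitantZero (comp I (power I J k) P) J := by
  induction k with
  | zero => rwa [comp_power_zero]
  | succ k ih =>
    intro α X hα hX x
    rw [comp_power_succ, dualConcomitant_comp (hP.comp_power hJ.smooth hc k).1 hJ hα hX,
      ih α X hα hX, map_zero]

lemma isPoisson_iff_rel : IsPoisson I P ↔ IsBivector I P ∧ SchoutenRel P (fun _ => 0) := by
  rw [isPoisson_iff]
  exact and_congr_right fun hP => (schoutenRel_iff hP).symm

lemma app_zero (K : Endo I M) : app I K (fun _ => 0) = fun _ => 0 :=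
  funext fun x => map_zero (K x)

/-- The Jacobi hierarchy with `V = 0`: there `ConcomitantRel` says only that the concomitant
vanishes on fields `JPγ`. -/
theorem IsPoissonNijenhuis.isPoisson_power (h : IsPoissonNijenhuis I P J) (k : ℕ) :
    IsPoisson I (comp I (power I J k) P) := by
  obtain ⟨hP, hS⟩ := isPoisson_iff_rel.1 h.isPoisson
  have hD : ConcomitantRel P (fun _ => 0) J := by
    intro f γ hf hγ x
    rw [h.concomitantZero _ (sharp I (comp I J P) γ) hf.smoothForm
      (h.isNijenhuis.smooth.smoothVec_app (hP.smoothVec_sharp hγ))]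
    simp
  have h1 := (hD.schoutenRel_power hS hP h.isNijenhuis h.commutes k).2
  rw [app_zero] at h1
  exact isPoisson_iff_rel.2 ⟨(hP.comp_power h.isNijenhuis.smooth h.commutes k).1, h1⟩

/-! ### Compatibility -/

lemma Commutes.endo_power (hc : Commutes I J P) (k : ℕ) : Commutes I (power I J k) P := by
  induction k with
  | zero =>
    intro x a
    rw [power_zero_apply]
    rfl
  | succ k ih =>
    intro x a
    rw [power_succ_apply', hc, ih]
    congr 1
    ext v
    exact congrArg a (power_succ_apply J k x v).symm

/-- The dual concomitant telescopes: its value for `J^(m+1)` at `(α, X)` is the value for `J^m` at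
`(α, JX)` plus the value for `J` at `(ᵗJ^m α, X)`, because the mixed torsion of `J^m` and `J`
vanishes. -/
lemma ConcomitantZero.endo_power (h : ConcomitantZero P J) (hP : IsBivector I P)
    (hJ : IsNijenhuis I J) (hc : Commutes I J P) (m : ℕ) :
    ConcomitantZero P (power I J m) := by
  induction m with
  | zero =>
    intro α X hα hX x
    simp only [dualConcomitant, app_power_zero, power_zero_apply, transp_power_zero]
    abel
  | succ m ih =>
    intro α X hα hX x
    have hJX := hJ.smooth.smoothVec_app hX
    have h1 := ih α _ hα hJX x
    have h2 := h _ X (hJ.smooth.smoothForm_transp_power hα m) hX x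
    have h3 := hJ.mlieBracket_app_power_left (hP.smoothVec_sharp hα) hX m x
    have e1 : app I (power I J m) (app I J X) =
        app I (power I J (m + 1)) X :=
      funext fun y => (power_succ_apply' J m y _).symm
    have e2 : sharp I P (transp I (power I J m) α) =
        app I (power I J m) (sharp I P α) :=
      funext fun y => (hc.endo_power m y _).symm
    rw [dualConcomitant, e1] at h1
    rw [dualConcomitant, e2, ← transp_power_succ, h3] at h2
    rw [dualConcomitant, ← add_zero (0 : TangentSpace I x)]
    nth_rewrite 2 [← h1]
    rw [← h2]
    abel

/-- The vanishing of the Schouten bracket `[P, Q]`. -/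
def MixedRel (P Q : Biv I M) : Prop :=
  ∀ f g : M → ℝ, SmoothFun I f → SmoothFun I g → ∀ x,
    mlieBracket I (ham P f) (ham Q g) x + mlieBracket I (ham Q f) (ham P g) x =
      ham P (pb Q f g) x + ham Q (pb P f g) x

lemma MixedRel.symm (h : MixedRel P Q) : MixedRel Q P := fun f g hf hg x => by
  rw [add_comm, h f g hf hg, add_comm]

/-- Evaluate the vanishing concomitant of `P` and `J^m` at `df` and `X = Pdg`. Its four terms
become, through the Poisson relation for `P`, the four terms of the mixed relation for `P` and `J^m
P`. -/
lemma ConcomitantZero.mixedRel {m : ℕ} (h : ConcomitantZero P (power I J m))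
    (hP : IsBivector I P) (hS : SchoutenRel P (fun _ => 0)) (hJ : SmoothEndo I J)
    (hc : Commutes I J P) : MixedRel P (comp I (power I J m) P) := by
  intro f g hf hg x
  have hPm := (hP.comp_power hJ hc m).1
  have hcm := hc.endo_power m
  have hXg := hP.smoothVec_ham hg
  have h1 := h _ _ hf.smoothForm hXg x
  have h2 := hS.mlieBracket_sharp hP (hJ.smoothForm_transp_power hf.smoothForm m) hg x
  have h3 := sharp_lieForm_mvfderiv hP (hJ.smoothVec_app_power hXg m) hf x
  have h4 := hS f g hf hg x
  have h5 := mlieBracket_swap_apply (I := I) (V := ham (comp I (power I J m) P) f)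
    (W := ham P g) (x := x)
  have e1 : dir (app I (power I J m) (ham P g)) f = fun y => - pb (comp I (power I J m) P) f g y :=
    hPm.pb_swap g f
  have e2 : sharp I P (transp I (power I J m) (mvfderiv I f)) = ham (comp I (power I J m) P) f :=
    (hcm.comp_sharp _).symm
  have e3 : ham P (fun y => - pb (comp I (power I J m) P) f g y) x =
      - ham P (pb (comp I (power I J m) P) f g) x := by
    simp only [ham, sharp, mvfderiv_fun_neg, map_neg]
  rw [e2] at h2
  simp only [map_zero, smul_zero, dir, zero_smul, sub_zero, add_zero] at h2 h4
  rw [dualConcomitant, h3, e1, e3, ← h2] at h1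
  change mlieBracket I (ham P f) (ham (comp I (power I J m) P) g) x
    - power I J m x (mlieBracket I (ham P f) (ham P g) x)
    - _ + _ = 0 at h1
  rw [h4] at h1
  rw [h5, ← sub_eq_zero, ← h1]
  change _ - (_ + power I J m x (ham P (pb P f g) x)) = _
  abel

/-- `J^k P` and `J^(k+m) P` have vanishing Schouten bracket. -/
lemma IsPoissonNijenhuis.mixedRel_power_add (h : IsPoissonNijenhuis I P J) (k m : ℕ) :
    MixedRel (comp I (power I J k) P) (comp I (power I J (k + m)) P) := by
  obtain ⟨hP, -⟩ := isPoisson_iff_rel.1 h.isPoisson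
  obtain ⟨hk, hc⟩ := hP.comp_power h.isNijenhuis.smooth h.commutes k
  have hS := (isPoisson_iff_rel.1 (h.isPoisson_power k)).2
  have hD := (h.concomitantZero.comp_power hP h.isNijenhuis h.commutes k).endo_power hk
    h.isNijenhuis hc m
  have e : comp I (power I J (k + m)) P = comp I (power I J m) (comp I (power I J k) P) := by
    funext x
    ext1 a
    rw [add_comm]
    exact power_add_apply J m k x _
  rw [e]
  exact hD.mixedRel hk hS h.isNijenhuis.smooth hc

lemma IsPoissonNijenhuis.mixedRel_power (h : IsPoissonNijenhuis I P J) (k l : ℕ) :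
    MixedRel (comp I (power I J k) P) (comp I (power I J l) P) := by
  rcases le_total k l with hkl | hkl
  · obtain ⟨m, rfl⟩ := Nat.exists_eq_add_of_le hkl
    exact h.mixedRel_power_add k m
  · obtain ⟨m, rfl⟩ := Nat.exists_eq_add_of_le hkl
    exact (h.mixedRel_power_add l m).symm

lemma ham_sub_smul (P Q : Biv I M) (c : ℝ) (f : M → ℝ) :
    ham (fun x => P x - c • Q x) f = fun x => ham P f x - c • ham Q f x := rfl

lemma pb_sub_smul (P Q : Biv I M) (c : ℝ) (f g : M → ℝ) :
    pb (fun x => P x - c • Q x) f g = fun x => pb P f g x - c * pb Q f g x := by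
  funext x
  simp only [pb, ham_sub_smul, map_sub, map_smul, smul_eq_mul]

lemma dir_sub_const_mul (X : Vec I M) (c : ℝ) {u v : M → ℝ} (hu : SmoothFun I u)
    (hv : SmoothFun I v) (x : M) :
    dir X (fun x => u x - c * v x) x = dir X u x - c * dir X v x := by
  simp only [dir]
  rw [mvfderiv_fun_sub hu ((smoothFun_const c).mul hv), mvfderiv_fun_mul (smoothFun_const c) hv,
    mvfderiv_fun_const]
  simp only [smul_zero, add_zero, _root_.sub_apply, _root_.smul_apply, smul_eq_mul]

lemma IsBivector.sub_smul (hP : IsBivector I P) (hQ : IsBivector I Q) (c : ℝ) :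
    IsBivector I (fun x => P x - c • Q x) := by
  refine isBivector_of_smoothFun (fun x a b => ?_) fun f g hf hg => ?_
  · have h1 := hP.skew x a b
    have h2 := hQ.skew x a b
    simp only [_root_.sub_apply, _root_.smul_apply, map_sub, map_smul, smul_eq_mul] at h1 h2 ⊢
    rw [h1, h2]
    ring
  · have h := (hP.smoothFun_pb hf hg).sub ((smoothFun_const c).mul (hQ.smoothFun_pb hf hg))
    rw [← pb_sub_smul] at h
    exact h

/-- The Jacobiator of `P - cQ` is a quadratic polynomial in `c`. Its constant and leading
coefficients are the Jacobiators of `P` and `Q`, and the linear one is the mixed relation paired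
with `dk`. -/
lemma MixedRel.isPoisson_sub_smul (h : MixedRel P Q) (hP : IsPoisson I P) (hQ : IsPoisson I Q)
    (c : ℝ) : IsPoisson I (fun x => P x - c • Q x) := by
  obtain ⟨hP, hSP⟩ := isPoisson_iff.1 hP
  obtain ⟨hQ, hSQ⟩ := isPoisson_iff.1 hQ
  have hR := hP.sub_smul hQ c
  refine isPoisson_iff.2 ⟨hR, fun f g k hf hg hk x => ?_⟩
  have key : ∀ u v w : M → ℝ, SmoothFun I v → SmoothFun I w →
      pb (fun x => P x - c • Q x) u (pb (fun x => P x - c • Q x) v w) x =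
        pb P u (pb P v w) x - c * (pb P u (pb Q v w) x + pb Q u (pb P v w) x)
          + c * c * pb Q u (pb Q v w) x := by
    intro u v w hv hw
    have h1 := hP.smoothFun_pb hv hw
    have h2 := hQ.smoothFun_pb hv hw
    rw [pb_sub_smul _ _ _ u, pb_sub_smul _ _ _ v]
    have e1 := dir_sub_const_mul (ham P u) c h1 h2 x
    have e2 := dir_sub_const_mul (ham Q u) c h1 h2 x
    change dir (ham P u) _ x - c * dir (ham Q u) _ x = dir (ham P u) (pb P v w) x
      - c * (dir (ham P u) (pb Q v w) x + dir (ham Q u) (pb P v w) x)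
      + c * c * dir (ham Q u) (pb Q v w) x
    rw [e1, e2]
    ring
  have hm := congrArg (mvfderiv I k x) (h f g hf hg x)
  rw [map_add, map_add, dir_mlieBracket hk (hP.smoothVec_ham hf) (hQ.smoothVec_ham hg),
    dir_mlieBracket hk (hQ.smoothVec_ham hf) (hP.smoothVec_ham hg)] at hm
  change pb P f (pb Q g k) x - pb Q g (pb P f k) x + (pb Q f (pb P g k) x - pb P g (pb Q f k) x)
    = pb P (pb Q f g) k x + pb Q (pb P f g) k x at hm
  have e1 := pb_neg_right (Λ := Q) g (pb P k f) x
  have e2 := pb_neg_right (Λ := P) g (pb Q k f) x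
  rw [← hP.pb_swap f k] at e1
  rw [← hQ.pb_swap f k] at e2
  have e3 := congrFun (hP.pb_swap (pb Q f g) k) x
  have e4 := congrFun (hQ.pb_swap (pb P f g) k) x
  have hp := hSP f g k hf hg hk x
  have hq := hSQ f g k hf hg hk x
  simp only [schoutenTerm, dir, map_zero, zero_mul, add_zero] at hp hq ⊢
  rw [key f g k hg hk, key g k f hk hf, key k f g hf hg]
  rw [e1, e2, e3, e4] at hm
  linear_combination hp + c * c * hq - c * hm

/-- The Poisson structures of the hierarchy form Poisson pencils. -/
theorem IsPoissonNijenhuis.isPoisson_pencil (h : IsPoissonNijenhuis I P J) (k l : ℕ) (c : ℝ) :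
    IsPoisson I (fun x => comp I (power I J k) P x - c • comp I (power I J l) P x) :=
  (h.mixedRel_power k l).isPoisson_sub_smul (h.isPoisson_power k) (h.isPoisson_power l) c

/-! ### Homogeneity -/

/-- `Z(P(df, dg)) = P(d(Zf), dg) + P(df, d(Zg)) - P(df, dg)`, that is `[Z, P] = - P`. -/
def HomogeneousRel (P : Biv I M) (Z : Vec I M) : Prop :=
  ∀ f g : M → ℝ, SmoothFun I f → SmoothFun I g → ∀ x,
    dir Z (pb P f g) x = pb P (dir Z f) g x + pb P f (dir Z g) x - pb P f g x

/-- `L_Z J` need not vanish, but `P`, and therefore `J^k P`, annihilates the image of `L_Z ∘ ᵗJ - ᵗJ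
∘ L_Z`. So the statement for `J^k P` at `ᵗJα` is the statement for `J^(k+1) P` at `α`. -/
lemma IsHomogeneousPoissonNijenhuis.lieSharp_power (h : IsHomogeneousPoissonNijenhuis I P J Z)
    (k : ℕ) {α : Form I M} (hα : SmoothForm I α) (x : M) :
    lieSharp Z (comp I (power I J k) P) α x = - comp I (power I J k) P x (α x) := by
  have hP := h.isPoissonNijenhuis.isPoisson.isBivector
  have hJ := h.isPoissonNijenhuis.isNijenhuis
  have hc := h.isPoissonNijenhuis.commutes
  induction k generalizing α with
  | zero =>
    rw [comp_power_zero]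
    refine tangent_ext fun g hg => ?_
    rw [← lieBiv_eq hP Z hα hg.smoothForm, h.homogeneous _ _ hα hg.smoothForm, map_neg]
    rfl
  | succ k ih =>
    have hck := (hP.comp_power hJ.smooth hc k).2
    have h1 := ih (hJ.smooth.smoothForm_transp hα)
    have h2 : comp I (power I J k) P x
        (lieForm I Z (transp I J α) x - transp I J (lieForm I Z α) x) = 0 := by
      change power I J k x (P x _) = 0
      rw [h.comp_eq_zero α hα x, map_zero]
    rw [map_sub, sub_eq_zero] at h2
    rw [comp_power_succ]
    rw [lieSharp, h2, ← hck.comp_sharp] at h1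
    have e1 : comp I (power I J k) P x (transp I J (lieForm I Z α) x) =
      comp I J (comp I (power I J k) P) x (lieForm I Z α x) := (hck x _).symm
    have e2 : comp I (power I J k) P x (transp I J α x) =
      comp I J (comp I (power I J k) P) x (α x) := (hck x _).symm
    rw [e1, e2] at h1
    exact h1

lemma IsHomogeneousPoissonNijenhuis.homogeneousRel_power
    (h : IsHomogeneousPoissonNijenhuis I P J Z) (k : ℕ) :
    HomogeneousRel (comp I (power I J k) P) Z := by
  intro f g hf hg x
  have hQ := (h.isPoissonNijenhuis.isPoisson_power k).isBivector
  have h1 := h.lieSharp_power k hf.smoothForm x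
  rw [lieSharp_mvfderiv hQ h.smoothVec hf] at h1
  have h2 := congrArg (mvfderiv I g x) h1
  rw [map_sub, map_neg, dir_mlieBracket hg h.smoothVec (hQ.smoothVec_ham hf)] at h2
  change dir Z (pb _ f g) x - pb _ f (dir Z g) x - pb _ (dir Z f) g x = - pb _ f g x at h2
  linear_combination h2

lemma HomogeneousRel.sub_smul (hP : HomogeneousRel P Z) (hQ : HomogeneousRel Q Z)
    (bP : IsBivector I P) (bQ : IsBivector I Q) (c : ℝ) :
    HomogeneousRel (fun x => P x - c • Q x) Z := by
  intro f g hf hg x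
  have h1 := hP f g hf hg x
  have h2 := hQ f g hf hg x
  have e := dir_sub_const_mul Z c (bP.smoothFun_pb hf hg) (bQ.smoothFun_pb hf hg) x
  simp only [pb_sub_smul]
  rw [e, h1, h2]
  ring

end PoissonNijenhuis

/-! ### Jacobi structures induced on transverse hypersurfaces -/

section Hypersurface

variable {E : Type*} [NormedAddCommGroup E] [NormedSpace ℝ E] [FiniteDimensional ℝ E]
  {H : Type*} [TopologicalSpace H] {I : ModelWithCorners ℝ E H} [I.Boundaryless]
  {M : Type*} [TopologicalSpace M] [ChartedSpace H M] [IsManifold I ∞ M] [T2Space M]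
  {E' : Type*} [NormedAddCommGroup E'] [NormedSpace ℝ E'] [FiniteDimensional ℝ E']
  {H' : Type*} [TopologicalSpace H'] {I' : ModelWithCorners ℝ E' H'} [I'.Boundaryless]
  {N : Type*} [TopologicalSpace N] [ChartedSpace H' N] [IsManifold I' ∞ N] [T2Space N]
  {Z : Vec I M} {ι : N → M}

/-! ### Coordinates adapted to a transverse hypersurface -/

/-- The inverse function theorem, with smoothness of the inverse near the point. -/
lemma exists_localInverse {Ψ : E' × ℝ → E} {p : E' × ℝ} {e : (E' × ℝ) ≃L[ℝ] E}
    (hΨ : ∀ᶠ q in 𝓝 p, ContDiffAt ℝ ∞ Ψ q) (he : HasFDerivAt Ψ (e : E' × ℝ →L[ℝ] E) p) :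
    ∃ Φ : E → E' × ℝ, (∀ᶠ z in 𝓝 (Ψ p), ContDiffAt ℝ ∞ Φ z) ∧ (∀ᶠ q in 𝓝 p, Φ (Ψ q) = q) ∧
      HasFDerivAt Φ (e.symm : E →L[ℝ] E' × ℝ) (Ψ p) := by
  have h0 := hΨ.self_of_nhds
  let Θ := h0.toOpenPartialHomeomorph Ψ he (by simp)
  have hp : p ∈ Θ.source := h0.mem_toOpenPartialHomeomorph_source he (by simp)
  have ht : Ψ p ∈ Θ.target := h0.image_mem_toOpenPartialHomeomorph_target he (by simp)
  have hinv : Θ.symm (Ψ p) = p := Θ.left_inv hp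
  -- Smoothness of the inverse is needed at all nearby points, hence invertibility of the derivative
  -- there; invertible operators form an open set.
  have h1 : ∀ᶠ q in 𝓝 p, fderiv ℝ Ψ q ∈ range ((↑) : ((E' × ℝ) ≃L[ℝ] E) → (E' × ℝ →L[ℝ] E)) := by
    have hc : ContinuousAt (fderiv ℝ Ψ) p :=
      (h0.fderiv_right (m := 0) (by simp)).continuousAt
    have := ContinuousLinearEquiv.nhds e
    rw [← he.fderiv] at this
    exact hc.eventually this
  refine ⟨Θ.symm, ?_, ?_, ?_⟩
  · have hc : Tendsto Θ.symm (𝓝 (Ψ p)) (𝓝 p) := by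
      have := Θ.continuousAt_symm ht
      rwa [ContinuousAt, hinv] at this
    filter_upwards [Θ.open_target.mem_nhds ht, hc.eventually hΨ, hc.eventually h1]
      with z hz hz1 hz2
    obtain ⟨e', he'⟩ := hz2
    refine Θ.contDiffAt_symm (f₀' := e') hz ?_ hz1
    rw [he']
    exact (hz1.differentiableAt (by simp)).hasFDerivAt
  · filter_upwards [Θ.open_source.mem_nhds hp] with q hq using Θ.left_inv hq
  · refine Θ.hasFDerivAt_symm ht ?_
    rw [hinv]
    exact he

lemma exists_equiv_of_injective {d : E' →L[ℝ] E} (hd : Function.Injective d) {z : E}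
    (hz : z ∉ range d) (hdim : Module.finrank ℝ E = Module.finrank ℝ E' + 1) :
    ∃ e : (E' × ℝ) ≃L[ℝ] E, ∀ v t, e (v, t) = d v + t • z := by
  let L : E' × ℝ →L[ℝ] E := d.comp (ContinuousLinearMap.fst ℝ E' ℝ)
    + (ContinuousLinearMap.snd ℝ E' ℝ).smulRight z
  have hL : ∀ v t, L (v, t) = d v + t • z := fun v t => rfl
  have hLinj : Function.Injective (L : E' × ℝ →ₗ[ℝ] E) := by
    refine (injective_iff_map_eq_zero _).2 ?_
    rintro ⟨v, t⟩ hvt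
    have h1 : d v + t • z = 0 := hvt
    have ht : t = 0 := by
      by_contra ht
      refine hz ⟨- (t⁻¹ • v), ?_⟩
      rw [map_neg, map_smul, eq_neg_of_add_eq_zero_left h1, smul_neg, neg_neg, smul_smul,
        inv_mul_cancel₀ ht, one_smul]
    subst ht
    rw [zero_smul, add_zero] at h1
    rw [hd (h1.trans (map_zero d).symm)]
    rfl
  have hdim' : Module.finrank ℝ (E' × ℝ) = Module.finrank ℝ E := by
    rw [hdim, Module.finrank_prod, Module.finrank_self]
  exact ⟨(LinearEquiv.ofInjectiveOfFinrankEq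
    (L : E' × ℝ →ₗ[ℝ] E) hLinj hdim').toContinuousLinearEquiv, hL⟩

/-- In charts, `(v, t) ↦ ι(v) + t Z(ι y)` is a local diffeomorphism by transversality and
codimension one; `ρ` is its local inverse. The vector `Z` is frozen at `ι y`, so it is straightened
at that point only. As `ι` is just an immersion, the claims along `N` hold for points near `y` in
`N`. -/
lemma exists_straightening (h : IsTransverseHypersurface I I' Z ι) (y : N) :
    ∃ ρ : M → E' × ℝ, (∀ᶠ x in 𝓝 (ι y), ContMDiffAt I 𝓘(ℝ, E' × ℝ) ∞ ρ x) ∧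
      (∀ᶠ y' in 𝓝 y, ρ (ι y') = (extChartAt I' y y', 0)) ∧
      (mfderiv I 𝓘(ℝ, E' × ℝ) ρ (ι y) : E →L[ℝ] E' × ℝ) (Z (ι y)) = ((0, 1) : E' × ℝ) := by
  set φ := extChartAt I (ι y) with hφ
  set ψ := extChartAt I' y with hψ
  obtain ⟨A, hA⟩ := isInvertible_mfderiv_extChartAt (I := I) (mem_extChartAt_source (I := I) (ι y))
  obtain ⟨B, hB⟩ := isInvertible_mfderivWithin_extChartAt_symm (I := I')
    (mem_extChartAt_target (I := I') y)
  have hxx : ψ.symm (ψ y) = y := extChartAt_to_inv y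
  have hιc : ContinuousAt ι y := h.smooth.continuous.continuousAt
  let z₀ : E := A (Z (ι y))
  let j : E' → E := fun v => φ (ι (ψ.symm v))
  have hsymm : ∀ v ∈ ψ.target, ContMDiffAt 𝓘(ℝ, E') I' ∞ ψ.symm v := fun v hv =>
    (contMDiffOn_extChartAt_symm (I := I') (n := ∞) y v hv).contMDiffAt
      ((isOpen_extChartAt_target y).mem_nhds hv)
  have hj : ∀ᶠ v in 𝓝 (ψ y), ContDiffAt ℝ ∞ j v := by
    have hc : Tendsto (fun v => ι (ψ.symm v)) (𝓝 (ψ y)) (𝓝 (ι y)) := by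
      have h1 : Tendsto ψ.symm (𝓝 (ψ y)) (𝓝 y) := by
        have := continuousAt_extChartAt_symm (I := I') y
        rwa [ContinuousAt, extChartAt_to_inv] at this
      exact hιc.tendsto.comp h1
    filter_upwards [extChartAt_target_mem_nhds (I := I') y,
      hc.eventually (chart_source_mem_nhds H (ι y))] with v hv hv'
    exact ((contMDiffAt_extChartAt' hv').comp v ((h.smooth _).comp v (hsymm v hv))).contDiffAt
  have hD : ∀ v, fderiv ℝ j (ψ y) v = A (mfderiv I' I ι y (B v)) := by
    intro v
    have m1 : MDifferentiableAt I 𝓘(ℝ, E) φ (ι (ψ.symm (ψ y))) := by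
      rw [hxx]; exact mdifferentiableAt_extChartAt (mem_chart_source H (ι y))
    have m2 : MDifferentiableAt I' I ι (ψ.symm (ψ y)) := (h.smooth _).mdifferentiableAt (by simp)
    have m3 : MDifferentiableAt 𝓘(ℝ, E') I' ψ.symm (ψ y) :=
      (hsymm _ (mem_extChartAt_target y)).mdifferentiableAt (by simp)
    have c1 := mfderiv_comp (ψ y) m2 m3
    have c2 := mfderiv_comp (ψ y) m1 (m2.comp (ψ y) m3)
    rw [c1, mfderiv_eq_fderiv] at c2
    -- The base point `ψ.symm (ψ y)` equals `y` only propositionally, so derivatives at the two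
    -- points are compared as maps of the model spaces.
    have k1 : ∀ x, x = y → ∀ v, (mfderiv I 𝓘(ℝ, E) φ (ι x) : E →L[ℝ] E) v = A v := by
      rintro _ rfl v
      exact congrArg (fun L : E →L[ℝ] E => L v) hA.symm
    have k2 : ∀ x, x = y → ∀ v, (mfderiv I' I ι x : E' →L[ℝ] E) v =
        (mfderiv I' I ι y : E' →L[ℝ] E) v := by
      rintro _ rfl v
      rfl
    have k3 : (mfderiv 𝓘(ℝ, E') I' ψ.symm (ψ y) : E' →L[ℝ] E') v = B v := by
      rw [I'.range_eq_univ, mfderivWithin_univ] at hB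
      exact congrArg (fun L : E' →L[ℝ] E' => L v) hB.symm
    refine (congrArg (fun L : E' →L[ℝ] E => L v) c2).trans ?_
    refine (k1 _ hxx _).trans (congrArg A ((k2 _ hxx _).trans ?_))
    exact congrArg (mfderiv I' I ι y : E' →L[ℝ] E) k3
  have hinj : Function.Injective (fderiv ℝ j (ψ y)) := fun v w hvw =>
    B.injective (h.injective y (A.injective ((hD v).symm.trans (hvw.trans (hD w)))))
  have hrange : z₀ ∉ range (fderiv ℝ j (ψ y)) := fun ⟨v, hv⟩ =>
    h.transverse y ⟨B v, A.injective ((hD v).symm.trans hv)⟩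
  obtain ⟨e, heL⟩ := exists_equiv_of_injective hinj hrange h.codim
  let Ψ : E' × ℝ → E := fun q => j q.1 + q.2 • z₀
  have hΨ : ∀ᶠ q in 𝓝 (ψ y, (0 : ℝ)), ContDiffAt ℝ ∞ Ψ q := by
    filter_upwards [continuousAt_fst.eventually hj] with q hq
    exact (hq.comp q contDiffAt_fst).add (contDiffAt_snd.smul contDiffAt_const)
  have he : HasFDerivAt Ψ (e : E' × ℝ →L[ℝ] E) (ψ y, (0 : ℝ)) := by
    have he' : (e : E' × ℝ →L[ℝ] E) = (fderiv ℝ j (ψ y)).comp (ContinuousLinearMap.fst ℝ E' ℝ)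
        + (ContinuousLinearMap.snd ℝ E' ℝ).smulRight z₀ :=
      ContinuousLinearMap.ext fun q => heL q.1 q.2
    rw [he']
    have h1 : HasFDerivAt j (fderiv ℝ j (ψ y)) (ψ y) :=
      (hj.self_of_nhds.differentiableAt (by simp)).hasFDerivAt
    exact (HasFDerivAt.comp (g := j) (ψ y, (0 : ℝ)) h1 hasFDerivAt_fst).add
      (hasFDerivAt_snd.smul_const z₀)
  obtain ⟨Φ, hΦ, hΦΨ, hΦ'⟩ := exists_localInverse hΨ he
  have hΨ0 : Ψ (ψ y, 0) = φ (ι y) := by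
    change φ (ι (ψ.symm (ψ y))) + (0 : ℝ) • z₀ = _
    rw [hxx, zero_smul, add_zero]
  rw [hΨ0] at hΦ hΦ'
  refine ⟨Φ ∘ φ, ?_, ?_, ?_⟩
  · filter_upwards [chart_source_mem_nhds H (ι y),
      (continuousAt_extChartAt (I := I) (ι y)).eventually hΦ] with x hx hx'
    exact hx'.contMDiffAt.comp x (contMDiffAt_extChartAt' hx)
  · have hc : Tendsto (fun y' => (ψ y', (0 : ℝ))) (𝓝 y) (𝓝 (ψ y, 0)) :=
      (continuousAt_extChartAt (I := I') y).prodMk continuousAt_const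
    filter_upwards [extChartAt_source_mem_nhds (I := I') y, hc.eventually hΦΨ] with y' hy' hy''
    have h1 : Ψ (ψ y', 0) = φ (ι y') := by
      change φ (ι (ψ.symm (ψ y'))) + (0 : ℝ) • z₀ = _
      rw [ψ.left_inv hy', zero_smul, add_zero]
    rw [h1] at hy''
    exact hy''
  · have h1 := mfderiv_comp (ι y) hΦ'.differentiableAt.mdifferentiableAt
      (mdifferentiableAt_extChartAt (I := I) (mem_chart_source H (ι y)))
    rw [mfderiv_eq_fderiv, ← hA, hΦ'.fderiv] at h1
    refine (congrArg (fun L : E →L[ℝ] E' × ℝ => L (Z (ι y))) h1).trans ?_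
    refine e.injective ((e.apply_symm_apply z₀).trans ?_)
    rw [heL, map_zero, zero_add, one_smul]

/-- A transverse hypersurface is locally the zero set of a function `s` with `Zs = 1` at a given
point. -/
lemma IsTransverseHypersurface.exists_defining (h : IsTransverseHypersurface I I' Z ι) (y : N) :
    ∃ s : M → ℝ, SmoothFun I s ∧ (∀ᶠ y' in 𝓝 y, s (ι y') = 0) ∧ dir Z s (ι y) = 1 := by
  obtain ⟨ρ, hρ, hρι, hρZ⟩ := exists_straightening h y
  have h1 : ∀ᶠ x in 𝓝 (ι y), ContMDiffAt I 𝓘(ℝ, ℝ) ∞ (fun x => (ρ x).2) x := by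
    filter_upwards [hρ] with x hx
    exact (contDiff_snd (𝕜 := ℝ) (E := E') (F := ℝ)).contMDiff.contMDiffAt.comp x hx
  obtain ⟨s, hs, hsρ⟩ := exists_smoothFun_eventuallyEq h1
  refine ⟨s, hs, ?_, ?_⟩
  · filter_upwards [hρι, h.smooth.continuous.continuousAt.eventually hsρ] with y' h2 h3
    rw [h3, h2]
  · rw [dir, mvfderiv_congr hsρ]
    have h2 := mfderiv_comp (ι y) ((contDiff_snd (𝕜 := ℝ) (E := E') (F := ℝ)
      (n := ∞)).contMDiff.contMDiffAt.mdifferentiableAt (by simp))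
      (hρ.self_of_nhds.mdifferentiableAt (by simp))
    rw [mfderiv_eq_fderiv, fderiv_snd] at h2
    refine (congrArg (fun L : E →L[ℝ] ℝ => L (Z (ι y))) h2).trans ?_
    exact congrArg Prod.snd hρZ

/-- Smooth functions on a transverse hypersurface extend locally. -/
lemma IsTransverseHypersurface.exists_extension (h : IsTransverseHypersurface I I' Z ι) (y : N)
    {f : N → ℝ} (hf : SmoothFun I' f) :
    ∃ F : M → ℝ, SmoothFun I F ∧ ∀ᶠ y' in 𝓝 y, F (ι y') = f y' := by
  obtain ⟨ρ, hρ, hρι, -⟩ := exists_straightening h y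
  set ψ := extChartAt I' y with hψ
  have hρc : ContinuousAt ρ (ι y) := hρ.self_of_nhds.continuousAt
  have hρy : (ρ (ι y)).1 = ψ y := by rw [hρι.self_of_nhds]
  have hc : Tendsto (fun x => (ρ x).1) (𝓝 (ι y)) (𝓝 (ψ y)) := by
    rw [← hρy]
    exact hρc.fst
  have h1 : ∀ᶠ x in 𝓝 (ι y), ContMDiffAt I 𝓘(ℝ, ℝ) ∞ (fun x => f (ψ.symm (ρ x).1)) x := by
    filter_upwards [hρ, hc.eventually (extChartAt_target_mem_nhds (I := I') y)] with x hx hx'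
    have h2 : ContMDiffAt I 𝓘(ℝ, E') ∞ (fun x => (ρ x).1) x :=
      (contDiff_fst (𝕜 := ℝ) (E := E') (F := ℝ)).contMDiff.contMDiffAt.comp x hx
    have h3 : ContMDiffAt 𝓘(ℝ, E') I' ∞ ψ.symm (ρ x).1 :=
      (contMDiffOn_extChartAt_symm (I := I') (n := ∞) y _ hx').contMDiffAt
        ((isOpen_extChartAt_target y).mem_nhds hx')
    exact (hf _).comp x (h3.comp x h2)
  obtain ⟨F, hF, hFρ⟩ := exists_smoothFun_eventuallyEq h1
  refine ⟨F, hF, ?_⟩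
  filter_upwards [hρι, h.smooth.continuous.continuousAt.eventually hFρ,
    extChartAt_source_mem_nhds (I := I') y] with y' h2 h3 h4
  rw [h3, h2]
  exact congrArg f (ψ.left_inv h4)

lemma dir_fun_add (X : Vec I M) {f g : M → ℝ} (hf : SmoothFun I f) (hg : SmoothFun I g) (x : M) :
    dir X (fun x => f x + g x) x = dir X f x + dir X g x := by
  rw [dir, mvfderiv_fun_add hf hg]
  rfl

lemma dir_fun_mul (X : Vec I M) {f g : M → ℝ} (hf : SmoothFun I f) (hg : SmoothFun I g) (x : M) :
    dir X (fun x => f x * g x) x = f x * dir X g x + g x * dir X f x := by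
  rw [dir, mvfderiv_fun_mul hf hg]
  rfl

lemma dir_fun_const (X : Vec I M) (c : ℝ) (x : M) : dir X (fun _ => c) x = 0 := by
  rw [dir, mvfderiv_fun_const]
  rfl

/-- Smooth functions on a transverse hypersurface extend locally to functions that are homogeneous
along the hypersurface, to second order at a given point. -/
lemma IsTransverseHypersurface.exists_homogeneous_extension
    (h : IsTransverseHypersurface I I' Z ι) (hZ : SmoothVec I Z) (y : N)
    {f : N → ℝ} (hf : SmoothFun I' f) :
    ∃ F : M → ℝ, SmoothFun I F ∧ (∀ᶠ y' in 𝓝 y, F (ι y') = f y') ∧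
      (∀ᶠ y' in 𝓝 y, dir Z F (ι y') = F (ι y')) ∧
      mvfderiv I (dir Z F) (ι y) = mvfderiv I F (ι y) := by
  obtain ⟨s, hs, hsι, hsZ⟩ := h.exists_defining y
  obtain ⟨F₀, hF₀, hFι⟩ := h.exists_extension y hf
  have hcont := h.smooth.continuous.continuousAt (x := y)
  have hs0 : s (ι y) = 0 := hsι.self_of_nhds
  have hZs := hs.dir hZ
  have hne : ∀ᶠ x in 𝓝 (ι y), dir Z s x ≠ 0 :=
    hZs.continuous.continuousAt.eventually_ne (by rw [hsZ]; exact one_ne_zero)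
  -- The extension is sought as `F₀ + s (u + c s)`. On `s = 0` the condition `ZF = F` reads `ZF₀ + u
  -- Zs = F₀`, which determines `u`.
  have hu0 : ∀ᶠ x in 𝓝 (ι y), ContMDiffAt I 𝓘(ℝ, ℝ) ∞
      (fun x => (F₀ x - dir Z F₀ x) / dir Z s x) x := by
    filter_upwards [hne] with x hx
    exact ((hF₀.sub (hF₀.dir hZ)) x).div₀ (hZs x) hx
  obtain ⟨u, hu, hu'⟩ := exists_smoothFun_eventuallyEq hu0
  have hZu := hu.dir hZ
  -- With this `u`, near `ι y` one has `ZF - F = s r` with `r = Zu - u + c (2 Zs - s)`. Its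
  -- differential at `ι y` is `r ds`; as `s = 0` and `Zs = 1` there, this `c` makes `r` vanish.
  set c : ℝ := - (dir Z u (ι y) - u (ι y)) / 2 with hc
  have hcs : SmoothFun I (fun x => c * s x) := (smoothFun_const c).mul hs
  have hw : SmoothFun I (fun x => u x + c * s x) := hu.add hcs
  have hF : SmoothFun I (fun x => F₀ x + s x * (u x + c * s x)) := hF₀.add (hs.mul hw)
  have hr : SmoothFun I (fun x => dir Z u x - u x + c * (2 * dir Z s x - s x)) :=
    (hZu.sub hu).add ((smoothFun_const c).mul (((smoothFun_const 2).mul hZs).sub hs))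
  have key : dir Z (fun x => F₀ x + s x * (u x + c * s x)) =ᶠ[𝓝 (ι y)] fun x =>
      (F₀ x + s x * (u x + c * s x)) +
        s x * (dir Z u x - u x + c * (2 * dir Z s x - s x)) := by
    filter_upwards [hne, hu'] with x hx hux
    have e : u x * dir Z s x = F₀ x - dir Z F₀ x := by rw [hux, div_mul_cancel₀ _ hx]
    rw [dir_fun_add Z hF₀ (hs.mul hw), dir_fun_mul Z hs hw, dir_fun_add Z hu hcs,
      dir_fun_mul Z (smoothFun_const c) hs, dir_fun_const]
    linear_combination e
  refine ⟨_, hF, ?_, ?_, ?_⟩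
  · filter_upwards [hsι, hFι] with y' h1 h2
    rw [h1, h2, zero_mul, add_zero]
  · filter_upwards [hsι, hcont.eventually key] with y' h1 h2
    rw [h2, h1]
    ring
  · rw [mvfderiv_congr key, mvfderiv_fun_add hF (hs.mul hr), mvfderiv_fun_mul hs hr, hs0, hsZ]
    have e : dir Z u (ι y) - u (ι y) + c * (2 * 1 - 0) = 0 := by rw [hc]; ring
    rw [e, zero_smul, zero_smul, add_zero, add_zero]

/-! ### Decomposition of bivectors -/

section Linear

variable {d : E' →L[ℝ] E} {z : E}

lemma exists_projection (hd : Function.Injective d) (hz : z ∉ range d)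
    (hdim : Module.finrank ℝ E = Module.finrank ℝ E' + 1) :
    ∃ (p : E →L[ℝ] E') (η : E →L[ℝ] ℝ), p.comp d = ContinuousLinearMap.id ℝ E' ∧ p z = 0 ∧
      η.comp d = 0 ∧ η z = 1 ∧ ∀ u, u = d (p u) + η u • z := by
  obtain ⟨e, he⟩ := exists_equiv_of_injective hd hz hdim
  have h1 : ∀ v, e.symm (d v) = (v, 0) := fun v => by
    rw [e.symm_apply_eq, he, zero_smul, add_zero]
  have h2 : e.symm z = (0, 1) := by
    rw [e.symm_apply_eq, he, map_zero, one_smul, zero_add]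
  refine ⟨(ContinuousLinearMap.fst ℝ E' ℝ).comp e.symm.toContinuousLinearMap,
    (ContinuousLinearMap.snd ℝ E' ℝ).comp e.symm.toContinuousLinearMap, ?_, ?_, ?_, ?_, ?_⟩
  · ext v
    exact congrArg Prod.fst (h1 v)
  · exact congrArg Prod.fst h2
  · ext v
    exact congrArg Prod.snd (h1 v)
  · exact congrArg Prod.snd h2
  · intro u
    exact (e.apply_symm_apply u).symm.trans (he _ _)

/-- With `p` the projection along `z` and `η` the covector equal to `1` on `z` and `0` on the image
of `d`, the pair is `L = p ∘ P ∘ ᵗp` and `v = p (P η)`. Skewness gives `η (P η) = 0`, so `P η` has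
no `z` component. -/
lemma exists_decomposition (hd : Function.Injective d) (hz : z ∉ range d)
    (hdim : Module.finrank ℝ E = Module.finrank ℝ E' + 1) {P : (E →L[ℝ] ℝ) →L[ℝ] E}
    (hP : ∀ a b : E →L[ℝ] ℝ, b (P a) = - a (P b)) :
    ∃ (L : (E' →L[ℝ] ℝ) →L[ℝ] E') (v : E'), ∀ a b : E →L[ℝ] ℝ,
      b (P a) = (b.comp d) (L (a.comp d)) + (a z * b (d v) - b z * a (d v)) := by
  obtain ⟨p, η, hpd, hpz, hηd, hηz, hu⟩ := exists_projection hd hz hdim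
  refine ⟨p.comp (P.comp ((ContinuousLinearMap.compL ℝ E E' ℝ).flip p)), p (P η), fun a b => ?_⟩
  change b (P a) = b (d (p (P ((a.comp d).comp p)))) +
    (a z * b (d (p (P η))) - b z * a (d (p (P η))))
  have hη : η (P η) = 0 := by
    have := hP η η
    linarith
  have ha : a = (a.comp d).comp p + a z • η := by
    ext u
    conv_lhs => rw [hu u, map_add, map_smul]
    change a (d (p u)) + η u * a z = a (d (p u)) + a z * η u
    ring
  have hdp : ∀ u, b (d (p u)) = b u - η u * b z := fun u => by
    conv_rhs => rw [hu u, map_add, map_smul]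
    have : η (d (p u)) = 0 := congrArg (fun L : E' →L[ℝ] ℝ => L (p u)) hηd
    rw [map_add, map_smul, this, hηz]
    simp
  have e1 : P a = P ((a.comp d).comp p) + a z • P η := by
    conv_lhs => rw [ha, map_add, map_smul]
  have e2 : η (P ((a.comp d).comp p)) = - a (d (p (P η))) := hP _ _
  rw [hdp, hdp, e1, map_add, map_smul, hη, e2, smul_eq_mul]
  ring

/-- Covectors `a ∘ p`, which vanish on `z`, recover `L`; pairing `η` with them recovers `v`. -/
lemma decomposition_unique (hd : Function.Injective d) (hz : z ∉ range d)
    (hdim : Module.finrank ℝ E = Module.finrank ℝ E' + 1)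
    {L L' : (E' →L[ℝ] ℝ) →L[ℝ] E'} {v v' : E'}
    (h : ∀ a b : E →L[ℝ] ℝ,
      (b.comp d) (L (a.comp d)) + (a z * b (d v) - b z * a (d v)) =
        (b.comp d) (L' (a.comp d)) + (a z * b (d v') - b z * a (d v'))) : L = L' ∧ v = v' := by
  obtain ⟨p, η, hpd, hpz, hηd, hηz, -⟩ := exists_projection hd hz hdim
  have hp : ∀ a : E' →L[ℝ] ℝ, (a.comp p).comp d = a := fun a => by
    rw [ContinuousLinearMap.comp_assoc, hpd, ContinuousLinearMap.comp_id]
  have ext' : ∀ u w : E', (∀ a : E' →L[ℝ] ℝ, a u = a w) → u = w := fun u w =>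
    (SeparatingDual.eq_iff_forall_dual_eq (R := ℝ) (V := E')).2
  constructor
  · ext1 a
    refine ext' _ _ fun b => ?_
    have := h (a.comp p) (b.comp p)
    rw [hp, hp] at this
    simpa [hpz] using this
  · refine ext' _ _ fun b => ?_
    have := h η (b.comp p)
    have e : ∀ w, p (d w) = w := fun w => congrArg (fun L : E' →L[ℝ] E' => L w) hpd
    have e' : ∀ w, η (d w) = 0 := fun w => congrArg (fun L : E' →L[ℝ] ℝ => L w) hηd
    rw [hηd, hp] at this
    simpa [hηz, hpz, e, e'] using this

lemma decomposition_skew (hd : Function.Injective d) (hz : z ∉ range d)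
    (hdim : Module.finrank ℝ E = Module.finrank ℝ E' + 1) {P : (E →L[ℝ] ℝ) →L[ℝ] E}
    (hP : ∀ a b : E →L[ℝ] ℝ, b (P a) = - a (P b)) {L : (E' →L[ℝ] ℝ) →L[ℝ] E'} {v : E'}
    (h : ∀ a b : E →L[ℝ] ℝ,
      b (P a) = (b.comp d) (L (a.comp d)) + (a z * b (d v) - b z * a (d v)))
    (a b : E' →L[ℝ] ℝ) : b (L a) = - a (L b) := by
  obtain ⟨p, η, hpd, hpz, -⟩ := exists_projection hd hz hdim
  have hp : ∀ a : E' →L[ℝ] ℝ, (a.comp p).comp d = a := fun a => by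
    rw [ContinuousLinearMap.comp_assoc, hpd, ContinuousLinearMap.comp_id]
  have h1 := hP (a.comp p) (b.comp p)
  rw [h, h, hp, hp] at h1
  simpa [hpz] using h1

end Linear

lemma IsTransverseHypersurface.exists_decomposesAlong (h : IsTransverseHypersurface I I' Z ι)
    (hQ : IsBivector I Q) : ∃ (Λ : Biv I' N) (V : Vec I' N), DecomposesAlong I I' Q Z ι Λ V := by
  have key : ∀ y : N, ∃ (L : (E' →L[ℝ] ℝ) →L[ℝ] E') (v : E'), ∀ a b : E →L[ℝ] ℝ,
      b (Q (ι y) a) = (b.comp (mfderiv I' I ι y : E' →L[ℝ] E))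
          (L (a.comp (mfderiv I' I ι y : E' →L[ℝ] E)))
        + (a (Z (ι y)) * b ((mfderiv I' I ι y : E' →L[ℝ] E) v)
          - b (Z (ι y)) * a ((mfderiv I' I ι y : E' →L[ℝ] E) v)) := fun y =>
    exists_decomposition (E := E) (E' := E') (h.injective y) (h.transverse y) h.codim
      (hQ.skew (ι y))
  choose L v hLv using key
  exact ⟨L, v, hLv⟩

lemma IsTransverseHypersurface.decomposesAlong_unique (h : IsTransverseHypersurface I I' Z ι)
    {Λ' : Biv I' N} {V' : Vec I' N} (h1 : DecomposesAlong I I' Q Z ι Λ V)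
    (h2 : DecomposesAlong I I' Q Z ι Λ' V') : Λ = Λ' ∧ V = V' := by
  have key : ∀ y, Λ y = Λ' y ∧ V y = V' y := fun y =>
    decomposition_unique (E := E) (E' := E') (h.injective y) (h.transverse y) h.codim
      fun a b => (h1 y a b).symm.trans (h2 y a b)
  exact ⟨funext fun y => (key y).1, funext fun y => (key y).2⟩

lemma DecomposesAlong.sub_smul {Q' : Biv I M} {Λ' : Biv I' N} {V' : Vec I' N}
    (h : DecomposesAlong I I' Q Z ι Λ V) (h' : DecomposesAlong I I' Q' Z ι Λ' V') (c : ℝ) :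
    DecomposesAlong I I' (fun x => Q x - c • Q' x) Z ι (fun y => Λ y - c • Λ' y)
      (fun y => V y - c • V' y) := by
  intro y a b
  have h1 := h y a b
  have h2 := h' y a b
  simp only [_root_.sub_apply, _root_.smul_apply, map_sub, map_smul, smul_eq_mul] at h1 h2 ⊢
  rw [h1, h2]
  ring

/-! ### The Jacobi structure of a transverse hypersurface -/

/-- For `ZF = F` and `ZG = G` at the point, the term `Z ∧ ι_* V` evaluated on `dF`, `dG` is
precisely the zeroth-order part of the Jacobi bracket; the chain rule matches the rest. -/
lemma DecomposesAlong.bracket_comp (h : DecomposesAlong I I' Q Z ι Λ V)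
    (hι : ContMDiff I' I ∞ ι) {F G : M → ℝ} {y : N}
    (hF : MDifferentiableAt I 𝓘(ℝ, ℝ) F (ι y)) (hG : MDifferentiableAt I 𝓘(ℝ, ℝ) G (ι y))
    (hZF : dir Z F (ι y) = F (ι y)) (hZG : dir Z G (ι y) = G (ι y)) :
    bracket I' Λ V (F ∘ ι) (G ∘ ι) y = pb Q F G (ι y) := by
  have hι' : MDifferentiableAt I' I ι y := (hι y).mdifferentiableAt (by simp)
  have h1 := h y (mvfderiv I F (ι y)) (mvfderiv I G (ι y))
  have h2 : mvfderiv I F (ι y) (Z (ι y)) = F (ι y) := hZF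
  have h3 : mvfderiv I G (ι y) (Z (ι y)) = G (ι y) := hZG
  rw [h2, h3] at h1
  simp only [bracket]
  rw [mvfderiv_comp y hF hι', mvfderiv_comp y hG hι']
  exact h1.symm

lemma DecomposesAlong.restrictsBracket (h : DecomposesAlong I I' Q Z ι Λ V)
    (hι : ContMDiff I' I ∞ ι) : RestrictsBracket I I' Q Z ι Λ V :=
  fun U _ _ hU hf hg hZf hZg y hy => h.bracket_comp hι
    ((hf.contMDiffAt (hU.mem_nhds hy)).mdifferentiableAt (by simp))
    ((hg.contMDiffAt (hU.mem_nhds hy)).mdifferentiableAt (by simp)) (hZf _ hy) (hZg _ hy)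

lemma bracket_congr {f f' g g' : N → ℝ} {y : N} (hf : f =ᶠ[𝓝 y] f') (hg : g =ᶠ[𝓝 y] g') :
    bracket I' Λ V f g y = bracket I' Λ V f' g' y := by
  simp only [bracket]
  rw [mvfderiv_congr hf, mvfderiv_congr hg, hf.eq_of_nhds, hg.eq_of_nhds]

lemma DecomposesAlong.bracket_eventuallyEq (h : DecomposesAlong I I' Q Z ι Λ V)
    (hι : ContMDiff I' I ∞ ι) {f g : N → ℝ} {F G : M → ℝ} {y : N}
    (hF : SmoothFun I F) (hG : SmoothFun I G)
    (hFf : ∀ᶠ y' in 𝓝 y, F (ι y') = f y') (hGg : ∀ᶠ y' in 𝓝 y, G (ι y') = g y')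
    (hZF : ∀ᶠ y' in 𝓝 y, dir Z F (ι y') = F (ι y'))
    (hZG : ∀ᶠ y' in 𝓝 y, dir Z G (ι y') = G (ι y')) :
    bracket I' Λ V f g =ᶠ[𝓝 y] pb Q F G ∘ ι := by
  filter_upwards [hFf.eventually_nhds, hGg.eventually_nhds, hZF, hZG] with y' h1 h2 h3 h4
  have h1' : F ∘ ι =ᶠ[𝓝 y'] f := h1
  have h2' : G ∘ ι =ᶠ[𝓝 y'] g := h2
  rw [← bracket_congr h1' h2']
  exact h.bracket_comp hι (hF.mdifferentiableAt _) (hG.mdifferentiableAt _) h3 h4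

/-- The fields arise from a pointwise choice. Their bracket is locally the restriction of a smooth
`Q(dF, dG)`; bracketing with `1` recovers `V`, and subtracting the zeroth-order terms then recovers
`Λ`. -/
lemma DecomposesAlong.smooth (hD : DecomposesAlong I I' Q Z ι Λ V) (hQ : IsBivector I Q)
    (hZ : SmoothVec I Z) (h : IsTransverseHypersurface I I' Z ι) :
    IsBivector I' Λ ∧ SmoothVec I' V := by
  have hb : ∀ f g : N → ℝ, SmoothFun I' f → SmoothFun I' g →
      SmoothFun I' (bracket I' Λ V f g) := by
    intro f g hf hg y
    obtain ⟨F, hF, hFf, hZF, -⟩ := h.exists_homogeneous_extension hZ y hf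
    obtain ⟨G, hG, hGg, hZG, -⟩ := h.exists_homogeneous_extension hZ y hg
    have hs : SmoothFun I' (pb Q F G ∘ ι) := ContMDiff.comp (hQ.smoothFun_pb hF hG) h.smooth
    exact (hs y).congr_of_eventuallyEq (hD.bracket_eventuallyEq h.smooth hF hG hFf hGg hZF hZG)
  have hV : ∀ f : N → ℝ, SmoothFun I' f → SmoothFun I' (dir V f) := by
    intro f hf
    have h1 := hb _ f (smoothFun_const 1) hf
    have e : bracket I' Λ V (fun _ => (1 : ℝ)) f = dir V f := by
      ext y
      simp [bracket, mvfderiv_fun_const, dir]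
    rwa [e] at h1
  refine ⟨isBivector_of_smoothFun (fun y a b => ?_) fun f g hf hg => ?_,
    smoothVec_of_smoothFun hV⟩
  · exact decomposition_skew (E := E) (E' := E') (h.injective y) (h.transverse y) h.codim
      (hQ.skew (ι y)) (hD y) a b
  · have h1 := (hb f g hf hg).sub ((hf.mul (hV g hg)).sub (hg.mul (hV f hf)))
    have e : (fun y => bracket I' Λ V f g y - (f y * dir V g y - g y * dir V f y)) =
        fun y => mvfderiv I' g y (Λ y (mvfderiv I' f y)) :=
      funext fun y => add_sub_cancel_right _ _
    rwa [e] at h1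

/-- A homogeneous Poisson structure induces a Jacobi structure on a transverse hypersurface. -/
theorem DecomposesAlong.isJacobi (hD : DecomposesAlong I I' Q Z ι Λ V) (hQ : IsPoisson I Q)
    (hH : HomogeneousRel Q Z) (hZ : SmoothVec I Z) (h : IsTransverseHypersurface I I' Z ι) :
    IsJacobi I' Λ V := by
  obtain ⟨hQ, hS⟩ := isPoisson_iff.1 hQ
  obtain ⟨hΛ, hV⟩ := hD.smooth hQ hZ h
  refine ⟨hΛ, hV, fun f₁ f₂ f₃ h₁ h₂ h₃ y => ?_⟩
  have key : ∀ {f g k : N → ℝ} {F G K : M → ℝ}, SmoothFun I F → SmoothFun I G → SmoothFun I K →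
      (∀ᶠ y' in 𝓝 y, F (ι y') = f y') → (∀ᶠ y' in 𝓝 y, G (ι y') = g y') →
      (∀ᶠ y' in 𝓝 y, K (ι y') = k y') →
      (∀ᶠ y' in 𝓝 y, dir Z F (ι y') = F (ι y')) → (∀ᶠ y' in 𝓝 y, dir Z G (ι y') = G (ι y')) →
      (∀ᶠ y' in 𝓝 y, dir Z K (ι y') = K (ι y')) →
      mvfderiv I (dir Z G) (ι y) = mvfderiv I G (ι y) →
      mvfderiv I (dir Z K) (ι y) = mvfderiv I K (ι y) →
      bracket I' Λ V f (bracket I' Λ V g k) y = pb Q F (pb Q G K) (ι y) := by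
    intro f g k F G K hF hG hK hf hg hk hZF hZG hZK dG dK
    have hGK := hQ.smoothFun_pb hG hK
    have hf' : f =ᶠ[𝓝 y] F ∘ ι := hf.mono fun _ h => h.symm
    rw [bracket_congr hf' (hD.bracket_eventuallyEq h.smooth hG hK hg hk hZG hZK)]
    refine hD.bracket_comp h.smooth (hF.mdifferentiableAt _) (hGK.mdifferentiableAt _)
      hZF.self_of_nhds ?_
    -- To iterate the bracket, `Q(dG, dK)` must itself be homogeneous at `ι y`. Homogeneity of `Q`
    -- reduces this to `d(ZG) = dG` and `d(ZK) = dK` at that point, which is why the extensions are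
    -- of second order.
    rw [hH G K hG hK]
    have e1 : pb Q (dir Z G) K (ι y) = pb Q G K (ι y) := by simp only [pb, ham, sharp, dG]
    have e2 : pb Q G (dir Z K) (ι y) = pb Q G K (ι y) := by simp only [pb, dK]
    rw [e1, e2]
    ring
  obtain ⟨F₁, s₁, e₁, z₁, d₁⟩ := h.exists_homogeneous_extension hZ y h₁
  obtain ⟨F₂, s₂, e₂, z₂, d₂⟩ := h.exists_homogeneous_extension hZ y h₂
  obtain ⟨F₃, s₃, e₃, z₃, d₃⟩ := h.exists_homogeneous_extension hZ y h₃
  rw [key s₁ s₂ s₃ e₁ e₂ e₃ z₁ z₂ z₃ d₂ d₃, key s₂ s₃ s₁ e₂ e₃ e₁ z₂ z₃ z₁ d₃ d₁,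
    key s₃ s₁ s₂ e₃ e₁ e₂ z₃ z₁ z₂ d₁ d₂]
  have := hS F₁ F₂ F₃ s₁ s₂ s₃ (ι y)
  simpa only [schoutenTerm, dir, map_zero, zero_mul, add_zero] using this

end Hypersurface

end JacobiNijenhuis

/-! ### Assembly of the two directions -/

theorem mainTheorem4
    {E : Type*} [NormedAddCommGroup E] [NormedSpace ℝ E] [FiniteDimensional ℝ E]
    {M : Type*} [TopologicalSpace M] [ChartedSpace E M] [IsManifold 𝓘(ℝ, E) ∞ M]
    [T2Space M] [SecondCountableTopology M] :
    (∀ (Λ : JacobiNijenhuis.Biv 𝓘(ℝ, E) M) (V : JacobiNijenhuis.Vec 𝓘(ℝ, E) M) (J : JacobiNijenhuis.Endo 𝓘(ℝ, E) M),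
      JacobiNijenhuis.IsJacobi 𝓘(ℝ, E) Λ V → JacobiNijenhuis.IsNijenhuis 𝓘(ℝ, E) J → JacobiNijenhuis.IsCompatible 𝓘(ℝ, E) Λ V J →
      ∃ (P : ℕ → JacobiNijenhuis.Biv (𝓘(ℝ, E).prod 𝓘(ℝ, ℝ)) (M × ℝ))
        (K : ℕ → JacobiNijenhuis.Endo (𝓘(ℝ, E).prod 𝓘(ℝ, ℝ)) (M × ℝ)),
        ∀ k : ℕ,
          JacobiNijenhuis.IsPoissonNijenhuis (𝓘(ℝ, E).prod 𝓘(ℝ, ℝ)) (P k) (K k) ∧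
          JacobiNijenhuis.IsConformalJacobiMorphism (𝓘(ℝ, E).prod 𝓘(ℝ, ℝ)) 𝓘(ℝ, E)
            (P k) (fun _ => 0)
            (JacobiNijenhuis.comp 𝓘(ℝ, E) (JacobiNijenhuis.power 𝓘(ℝ, E) J k) Λ) (JacobiNijenhuis.app 𝓘(ℝ, E) (JacobiNijenhuis.power 𝓘(ℝ, E) J k) V)
            (Prod.fst : M × ℝ → M)) ∧
    (∀ {F : Type*} [NormedAddCommGroup F] [NormedSpace ℝ F] [FiniteDimensional ℝ F]
        {N : Type*} [TopologicalSpace N] [ChartedSpace F N] [IsManifold 𝓘(ℝ, F) ∞ N]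
        [T2Space N] [SecondCountableTopology N]
        (P : JacobiNijenhuis.Biv 𝓘(ℝ, E) M) (J : JacobiNijenhuis.Endo 𝓘(ℝ, E) M) (Z : JacobiNijenhuis.Vec 𝓘(ℝ, E) M) (ι : N → M),
      JacobiNijenhuis.IsHomogeneousPoissonNijenhuis 𝓘(ℝ, E) P J Z →
      JacobiNijenhuis.IsTransverseHypersurface 𝓘(ℝ, E) 𝓘(ℝ, F) Z ι →
      ∃ (Λ : ℕ → JacobiNijenhuis.Biv 𝓘(ℝ, F) N) (V : ℕ → JacobiNijenhuis.Vec 𝓘(ℝ, F) N),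
        (∀ k : ℕ, JacobiNijenhuis.IsJacobi 𝓘(ℝ, F) (Λ k) (V k)) ∧
        (∀ k l : ℕ, JacobiNijenhuis.AreCompatible 𝓘(ℝ, F) (Λ k) (V k) (Λ l) (V l)) ∧
        (∀ k : ℕ, JacobiNijenhuis.DecomposesAlong 𝓘(ℝ, E) 𝓘(ℝ, F)
          (JacobiNijenhuis.comp 𝓘(ℝ, E) (JacobiNijenhuis.power 𝓘(ℝ, E) J k) P) Z ι (Λ k) (V k)) ∧
        (∀ k : ℕ, JacobiNijenhuis.RestrictsBracket 𝓘(ℝ, E) 𝓘(ℝ, F)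
          (JacobiNijenhuis.comp 𝓘(ℝ, E) (JacobiNijenhuis.power 𝓘(ℝ, E) J k) P) Z ι (Λ k) (V k)) ∧
        (∀ (k : ℕ) (Λ' : JacobiNijenhuis.Biv 𝓘(ℝ, F) N) (V' : JacobiNijenhuis.Vec 𝓘(ℝ, F) N),
          JacobiNijenhuis.DecomposesAlong 𝓘(ℝ, E) 𝓘(ℝ, F)
            (JacobiNijenhuis.comp 𝓘(ℝ, E) (JacobiNijenhuis.power 𝓘(ℝ, E) J k) P) Z ι Λ' V' →
          Λ' = Λ k ∧ V' = V k)) := by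
  refine ⟨fun Λ V J hΛV hJ hC => ?_, fun P J Z ι hP hι => ?_⟩
  · refine ⟨fun k => JacobiNijenhuis.poissonization
      (JacobiNijenhuis.comp 𝓘(ℝ, E) (JacobiNijenhuis.power 𝓘(ℝ, E) J k) Λ)
      (JacobiNijenhuis.app 𝓘(ℝ, E) (JacobiNijenhuis.power 𝓘(ℝ, E) J k) V),
      fun _ p => ContinuousLinearMap.id ℝ (TangentSpace (𝓘(ℝ, E).prod 𝓘(ℝ, ℝ)) p), fun k => ?_⟩
    have h := hC.isJacobi_power hΛV hJ k
    exact ⟨h.isPoisson_poissonization.isPoissonNijenhuis_id, h.isConformalJacobiMorphism_fst⟩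
  · have hPN := hP.isPoissonNijenhuis
    choose Λ V hD using fun k => hι.exists_decomposesAlong (hPN.isPoisson_power k).isBivector
    have hJac : ∀ k, JacobiNijenhuis.IsJacobi _ (Λ k) (V k) := fun k =>
      (hD k).isJacobi (hPN.isPoisson_power k) (hP.homogeneousRel_power k) hP.smoothVec hι
    refine ⟨Λ, V, hJac, fun k l => ⟨hJac k, hJac l, fun c => ?_⟩, hD,
      fun k => (hD k).restrictsBracket hι.smooth,
      fun k Λ' V' h => hι.decomposesAlong_unique h (hD k)⟩
    -- The difference on `N` is the structure induced by `J^k P - c J^l P`, which is again Poisson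
    -- and homogeneous.
    exact ((hD k).sub_smul (hD l) c).isJacobi (hPN.isPoisson_pencil k l c)
      ((hP.homogeneousRel_power k).sub_smul (hP.homogeneousRel_power l)
        (hPN.isPoisson_power k).isBivector (hPN.isPoisson_power l).isBivector c) hP.smoothVec hι
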